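/- **Proposition 2.5.** Let $\alpha\in\mathbb R$, $\beta>0$ be such that $g:=\tfrac12+\tfrac{\alpha}{\beta}>0$. For $k\ge 1$, $\lambda\in\mathbb C$, $x\in\mathbb R^k$, $y\in\mathbb R^{k-1}$ put $$\Lambda_\lambda(x|y)=\exp\Bigl(i\lambda\bigl(\textstyle\sum_{j=1}^k x_j-\sum_{j=1}^{k-1} y_j\bigr)-\sum_{j=1}^{k-1}\bigl(e^{x_j-y_j}+e^{y_j-x_{j+1}}\bigr)\Bigr),$$ and, for $\lambda\in\mathbb R$, $$\mathbb L_\lambda(x|y)=\frac{(2\beta)^{i\lambda}}{\Gamma(g-i\lambda)}\int_{\mathbb R^k}dz\;(1+\beta e^{-z_1})^{-i\lambda-g}(1-\beta e^{-z_1})^{-i\lambda+g-1}\,\theta(z_1-\ln\beta)$$ $$\times\exp\Bigl(i\lambda\bigl(\textstyle\sum_{j=1}^k x_j+\sum_{j=1}^{k-1} y_j-2\sum_{j=1}^k z_j\bigr)-\sum_{j=1}^{k-1}\bigl(e^{z_j-x_j}+e^{z_j-y_j}+e^{x_j-z_{j+1}}+e^{y_j-z_{j+1}}\bigr)-e^{z_k-x_k}\Bigr),$$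 where $\theta$ is the Heaviside step function ($\theta(t)=1$ for $t\ge0$ and $\theta(t)=0$ for $t<0$). Define the wave functions of the $GL_n$ and $BC_n$ quantum Toda chains recursively, starting from $1$ for zero variables, by $$\Phi_{\lambda_1,\dots,\lambda_k}(x)=\int_{\mathbb R^{k-1}}\Lambda_{\lambda_k}(x|y)\,\Phi_{\lambda_1,\dots,\lambda_{k-1}}(y)\,dy\quad(\lambda_j\in\mathbb C),$$ $$\Psi_{\lambda_1,\dots,\lambda_k}(x)=\int_{\mathbb R^{k-1}}\mathbb L_{\lambda_k}(x|y)\,\Psi_{\lambda_1,\dots,\lambda_{k-1}}(y)\,dy\quad(\lambda_j\in\mathbb R);$$ in particular $\Phi_{\lambda_1}(x_1)=e^{i\lambda_1x_1}$ and $\Psi_{\lambda_1}(x_1)=\mathbb L_{\lambda_1}(x_1|\,\cdot\,)$ (no variables $y$). Let $n\ge1$, $\lambda=(\lambda_1,\dots,\lambda_n)\in\mathbb R^n$, and let $\rho=(\rho_1,\dots,\rho_n)\in\mathbb C^n$ satisfy $\operatorname{Im}\rho_1=\dots=\operatorname{Im}\rho_n<0$. Then the following integral converges absolutely, and $$\int_{\mathbb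 R^n}\Phi_{-\rho}(x)\,\Psi_\lambda(x)\,\exp(-\beta e^{-x_1})\,dx=\frac{(2\beta)^{-i(\rho_1+\dots+\rho_n)}\prod_{j,k=1}^n\Gamma(i\rho_j+i\lambda_k)\,\Gamma(i\rho_j-i\lambda_k)}{\prod_{1\le j<k\le n}\Gamma(i\rho_j+i\rho_k)\,\prod_{j=1}^n\Gamma(g+i\rho_j)}.$$ -/

import Mathlib

open MeasureTheory

noncomputable section

namespace Toda

/-- The Heaviside step function, equal to `1` on `[0, ∞)` and to `0` on `(-∞, 0)`. -/
def heaviside (t : ℝ) : ℝ := if 0 ≤ t then 1 else 0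

/-- The coupling `g = 1/2 + α/β` of the `BC` Toda chain with boundary parameters `α, β`. -/
def coupling (α β : ℝ) : ℝ := 1 / 2 + α / β

/-- The kernel `Λ_lam(x | y)` of the `GL` raising operator from `m` to `m + 1` variables. -/
def glKernel {m : ℕ} (lam : ℂ) (x : Fin (m + 1) → ℝ) (y : Fin m → ℝ) : ℂ :=
  Complex.exp
    (Complex.I * lam * (((∑ j, x j) - ∑ j, y j : ℝ) : ℂ)
      - ((∑ j : Fin m, (Real.exp (x j.castSucc - y j) + Real.exp (y j - x j.succ)) : ℝ) : ℂ))

/-- The `GL` raising operator `Λ_{m+1}(lam)`. -/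
def glRaise {m : ℕ} (lam : ℂ) (φ : (Fin m → ℝ) → ℂ) (x : Fin (m + 1) → ℝ) : ℂ :=
  ∫ y : Fin m → ℝ, glKernel lam x y * φ y

/-- The boundary factor
`(1 + β e^{-t})^{-i lam - g} (1 - β e^{-t})^{-i lam + g - 1} θ(t - ln β)`. -/
def bcBoundary (β g : ℝ) (lam : ℂ) (t : ℝ) : ℂ :=
  ((1 + β * Real.exp (-t) : ℝ) : ℂ) ^ (-(Complex.I * lam) - (g : ℂ))
    * ((1 - β * Real.exp (-t) : ℝ) : ℂ) ^ (-(Complex.I * lam) + (g : ℂ) - 1)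
    * ((heaviside (t - Real.log β) : ℝ) : ℂ)

/-- The kernel of the `BC` raising operator from `m` to `m + 1` variables. -/
def bcKernel {m : ℕ} (β g : ℝ) (lam : ℂ) (x : Fin (m + 1) → ℝ) (y : Fin m → ℝ) : ℂ :=
  ((2 * β : ℝ) : ℂ) ^ (Complex.I * lam) / Complex.Gamma ((g : ℂ) - Complex.I * lam)
    * ∫ z : Fin (m + 1) → ℝ,
        bcBoundary β g lam (z 0)
          * Complex.exp
            (Complex.I * lam * (((∑ j, x j) + (∑ j, y j) - 2 * ∑ j, z j : ℝ) : ℂ)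
              - ((∑ j : Fin m,
                    (Real.exp (z j.castSucc - x j.castSucc) + Real.exp (z j.castSucc - y j)
                      + Real.exp (x j.castSucc - z j.succ) + Real.exp (y j - z j.succ)) : ℝ) : ℂ)
              - ((Real.exp (z (Fin.last m) - x (Fin.last m)) : ℝ) : ℂ))

/-- The `BC` raising operator from `m` to `m + 1` variables. -/
def bcRaise {m : ℕ} (β g : ℝ) (lam : ℂ) (φ : (Fin m → ℝ) → ℂ) (x : Fin (m + 1) → ℝ) : ℂ :=
  ∫ y : Fin m → ℝ, bcKernel β g lam x y * φ y

/-- The `GL` Toda wave function `Φ_lam(x) = Λ_n(lam_n) ⋯ Λ_1(lam_1) · 1`. -/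
def glWave : (n : ℕ) → (Fin n → ℂ) → (Fin n → ℝ) → ℂ
  | 0, _ => fun _ => 1
  | m + 1, lam => glRaise (lam (Fin.last m)) (glWave m (fun j => lam j.castSucc))

/-- The `BC` Toda wave function `Ψ_lam(x)`, the product of the `BC` raising operators with
spectral parameters `lam_n, …, lam_1` applied to the constant function `1`. -/
def bcWave (β g : ℝ) : (n : ℕ) → (Fin n → ℂ) → (Fin n → ℝ) → ℂ
  | 0, _ => fun _ => 1
  | m + 1, lam => bcRaise β g (lam (Fin.last m)) (bcWave β g m (fun j => lam j.castSucc))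

end Toda

end

/-!
All integrals are taken in the monoid of *dominated complex numbers*, pairs of a value and an upper
bound in `ℝ≥0∞` for its modulus. There Fubini's theorem holds unconditionally, so every identity
below is purely formal; absolute convergence is read off at the end from the Gamma factors, whose
bounds are finite.

The `GL` raising operators satisfy exchange relations, which follow from the symmetry of the Bessel
integrals in their index; they make the `GL` wave functions eigenfunctions of the Baxter operator.
For the `BC` chain the exchange of a raising operator with a transfer operator is, apart from Bessel
integrals, a symmetry of Riemann–Liouville transforms at the wall. Moving a transfer operator
through the scalar product with a `GL` wave function therefore removes one spectral parameter of
each kind and splits off the corresponding Gamma factors, and the formula follows by induction.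
-/

noncomputable section

namespace Toda

open scoped ENNReal

/-- Dominated complex numbers: a complex number with an upper bound for its absolute value, the
value being `0` as soon as the bound is infinite. They make the Fubini theorem unconditional: an
integral of dominated complex numbers carries the Lebesgue integral of the bounds along, and
convergence can be read off from that bound at the end. -/
@[ext]
structure DominatedComplex where
  val : ℂ
  bound : ℝ≥0∞
  enorm_val_le : ‖val‖ₑ ≤ bound
  val_eq_zero : bound = ∞ → val = 0

namespace DominatedComplex

theorem val_eq_zero_of_bound {d : DominatedComplex} (h : d.bound = 0) : d.val = 0 := by
  simpa [h] using d.enorm_val_le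

theorem ext_of_ne_top {d e : DominatedComplex} (h : d.bound = e.bound)
    (h' : d.bound ≠ ∞ → d.val = e.val) : d = e := by
  refine DominatedComplex.ext ?_ h
  by_cases ht : d.bound = ∞
  · exact (d.val_eq_zero ht).trans (e.val_eq_zero (h ▸ ht)).symm
  · exact h' ht

instance : One DominatedComplex := ⟨⟨1, 1, by simp, by simp⟩⟩

instance : Zero DominatedComplex := ⟨⟨0, 0, by simp, by simp⟩⟩

instance : Mul DominatedComplex where
  mul d e :=
    ⟨d.val * e.val, d.bound * e.bound,
      (enorm_mul _ _).trans_le (mul_le_mul' d.enorm_val_le e.enorm_val_le), fun h => by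
        rcases ENNReal.mul_eq_top.1 h with h | h
        · simp [e.val_eq_zero h.2]
        · simp [d.val_eq_zero h.1]⟩

@[simp] theorem val_one : (1 : DominatedComplex).val = 1 := rfl
@[simp] theorem bound_one : (1 : DominatedComplex).bound = 1 := rfl
@[simp] theorem val_zero : (0 : DominatedComplex).val = 0 := rfl
@[simp] theorem bound_zero : (0 : DominatedComplex).bound = 0 := rfl
@[simp] theorem val_mul (d e : DominatedComplex) : (d * e).val = d.val * e.val := rfl
@[simp] theorem bound_mul (d e : DominatedComplex) : (d * e).bound = d.bound * e.bound := rfl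

instance : CommMonoidWithZero DominatedComplex where
  mul_assoc _ _ _ := DominatedComplex.ext (mul_assoc _ _ _) (mul_assoc _ _ _)
  one_mul _ := DominatedComplex.ext (one_mul _) (one_mul _)
  mul_one _ := DominatedComplex.ext (mul_one _) (mul_one _)
  mul_comm _ _ := DominatedComplex.ext (mul_comm _ _) (mul_comm _ _)
  zero_mul _ := DominatedComplex.ext (zero_mul _) (zero_mul _)
  mul_zero _ := DominatedComplex.ext (mul_zero _) (mul_zero _)

@[simp] theorem val_prod {ι : Type*} (s : Finset ι) (f : ι → DominatedComplex) :
    (∏ i ∈ s, f i).val = ∏ i ∈ s, (f i).val :=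
  map_prod (⟨⟨val, rfl⟩, fun _ _ => rfl⟩ : DominatedComplex →* ℂ) f s

@[simp] theorem bound_prod {ι : Type*} (s : Finset ι) (f : ι → DominatedComplex) :
    (∏ i ∈ s, f i).bound = ∏ i ∈ s, (f i).bound :=
  map_prod (⟨⟨bound, rfl⟩, fun _ _ => rfl⟩ : DominatedComplex →* ℝ≥0∞) f s

/-- A complex number, dominated by its own absolute value. -/
def of (z : ℂ) : DominatedComplex := ⟨z, ‖z‖ₑ, le_rfl, fun h => absurd h enorm_ne_top⟩

@[simp] theorem val_of (z : ℂ) : (of z).val = z := rfl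
@[simp] theorem bound_of (z : ℂ) : (of z).bound = ‖z‖ₑ := rfl

@[simp] theorem of_zero : of 0 = 0 := DominatedComplex.ext rfl (by simp)

@[simp] theorem of_one : of 1 = 1 := DominatedComplex.ext rfl (by simp)

theorem of_mul (z w : ℂ) : of (z * w) = of z * of w := DominatedComplex.ext rfl (enorm_mul z w)

instance : MeasurableSpace DominatedComplex :=
  MeasurableSpace.comap (fun d => (d.val, d.bound)) inferInstance

variable {A B : Type*} [MeasurableSpace A] [MeasurableSpace B]

@[fun_prop] theorem measurable_val : Measurable val :=
  measurable_fst.comp (comap_measurable fun d : DominatedComplex => (d.val, d.bound))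

@[fun_prop] theorem measurable_bound : Measurable bound :=
  measurable_snd.comp (comap_measurable fun d : DominatedComplex => (d.val, d.bound))

theorem measurable_of_val_of_bound {F : A → DominatedComplex}
    (h : Measurable fun a => (F a).val) (h' : Measurable fun a => (F a).bound) : Measurable F :=
  measurable_comap_iff.2 (h.prodMk h')

@[fun_prop] theorem measurable_of : Measurable of :=
  measurable_of_val_of_bound (by simp only [val_of]; fun_prop) (by simp only [bound_of]; fun_prop)

instance : MeasurableMul₂ DominatedComplex :=
  ⟨measurable_of_val_of_bound (by simp only [val_mul]; fun_prop)
    (by simp only [bound_mul]; fun_prop)⟩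

open Classical in
/-- The integral of a function with values in the dominated complex numbers. -/
def dintegral (μ : Measure A) (F : A → DominatedComplex) : DominatedComplex where
  val := if ∫⁻ a, (F a).bound ∂μ = ∞ then 0 else ∫ a, (F a).val ∂μ
  bound := ∫⁻ a, (F a).bound ∂μ
  enorm_val_le := by
    split_ifs
    · simp
    · exact (enorm_integral_le_lintegral_enorm _).trans
        (lintegral_mono fun a => (F a).enorm_val_le)
  val_eq_zero h := if_pos h

end DominatedComplex

local notation "∫ᵈ " x ", " F:60 => DominatedComplex.dintegral volume fun x => F

namespace DominatedComplex

variable {A B : Type*} [MeasurableSpace A] [MeasurableSpace B] {μ : Measure A} {ν : Measure B}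
  {F G : A → DominatedComplex}

theorem bound_dintegral (μ : Measure A) (F : A → DominatedComplex) :
    (dintegral μ F).bound = ∫⁻ a, (F a).bound ∂μ := rfl

theorem val_dintegral (h : ∫⁻ a, (F a).bound ∂μ ≠ ∞) :
    (dintegral μ F).val = ∫ a, (F a).val ∂μ := if_neg h

theorem dintegral_congr (h : ∀ a, F a = G a) : dintegral μ F = dintegral μ G := by
  rw [funext h]

theorem dintegral_congr_ae (h : ∀ᵐ a ∂μ, F a = G a) : dintegral μ F = dintegral μ G := by
  have hbound : ∫⁻ a, (F a).bound ∂μ = ∫⁻ a, (G a).bound ∂μ :=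
    lintegral_congr_ae (h.mono fun a ha => by simp only [ha])
  refine ext_of_ne_top hbound fun ht => ?_
  rw [val_dintegral ht, val_dintegral (by rwa [← hbound])]
  exact integral_congr_ae (h.mono fun a ha => by simp only [ha])

theorem dintegral_zero (μ : Measure A) : dintegral μ (fun _ => 0) = 0 :=
  ext_of_ne_top (by simp [bound_dintegral]) fun h => by
    rw [val_dintegral (by rwa [← bound_dintegral])]; simp

theorem integrable_val (hF : Measurable F) (h : (dintegral μ F).bound ≠ ∞) :
    Integrable (fun a => (F a).val) μ :=
  ⟨(measurable_val.comp hF).aestronglyMeasurable,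
    (lintegral_mono fun a => (F a).enorm_val_le).trans_lt h.lt_top⟩

theorem dintegral_const_mul (μ : Measure A) (c : DominatedComplex) (hF : Measurable F) :
    dintegral μ (fun a => c * F a) = c * dintegral μ F := by
  have hbound : ∫⁻ a, (c * F a).bound ∂μ = c.bound * ∫⁻ a, (F a).bound ∂μ := by
    simp only [bound_mul]
    exact lintegral_const_mul _ (measurable_bound.comp hF)
  refine ext_of_ne_top hbound fun ht => ?_
  rw [val_dintegral ht]
  simp only [val_mul]
  rw [integral_const_mul]
  by_cases htop : ∫⁻ a, (F a).bound ∂μ = ∞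
  · have hc : c.bound = 0 := by
      by_contra hc
      exact ht (by rw [bound_dintegral, hbound, htop, ENNReal.mul_top hc])
    simp [val_eq_zero_of_bound hc]
  · rw [val_dintegral htop]

theorem dintegral_mul_const (μ : Measure A) (c : DominatedComplex) (hF : Measurable F) :
    dintegral μ (fun a => F a * c) = dintegral μ F * c := by
  simp only [mul_comm _ c, dintegral_const_mul μ c hF]

@[fun_prop] theorem measurable_dintegral [SFinite ν] {F : A → B → DominatedComplex}
    (hF : Measurable fun p : A × B => F p.1 p.2) : Measurable fun a => dintegral ν (F a) := by
  have hbound : Measurable fun a => ∫⁻ b, (F a b).bound ∂ν :=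
    Measurable.lintegral_prod_right' (measurable_bound.comp hF)
  refine measurable_of_val_of_bound ?_ hbound
  refine Measurable.ite (measurableSet_eq_fun hbound measurable_const) measurable_const ?_
  exact (StronglyMeasurable.integral_prod_right'
    (measurable_val.comp hF).stronglyMeasurable).measurable

theorem dintegral_prod [SFinite μ] [SFinite ν] {F : A × B → DominatedComplex}
    (hF : Measurable F) :
    dintegral (μ.prod ν) F = dintegral μ fun a => dintegral ν fun b => F (a, b) := by
  have hbound : ∫⁻ p, (F p).bound ∂μ.prod ν = ∫⁻ a, ∫⁻ b, (F (a, b)).bound ∂ν ∂μ :=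
    lintegral_prod _ (measurable_bound.comp hF).aemeasurable
  refine ext_of_ne_top hbound fun ht => ?_
  have hinner : Measurable fun a => ∫⁻ b, (F (a, b)).bound ∂ν :=
    Measurable.lintegral_prod_right' (measurable_bound.comp hF)
  rw [val_dintegral ht, integral_prod _ (integrable_val hF ht),
    val_dintegral (by simpa only [bound_dintegral, ← hbound] using ht)]
  refine integral_congr_ae ?_
  filter_upwards [ae_lt_top hinner (by rwa [bound_dintegral, hbound] at ht)] with a ha
  rw [val_dintegral ha.ne]

theorem dintegral_comp {e : A ≃ᵐ B} (he : MeasurePreserving e μ ν) (F : B → DominatedComplex) :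
    dintegral μ (fun a => F (e a)) = dintegral ν F := by
  have hbound : ∫⁻ a, (F (e a)).bound ∂μ = ∫⁻ b, (F b).bound ∂ν := by
    rw [← he.map_eq, lintegral_map_equiv]
  refine ext_of_ne_top hbound fun ht => ?_
  rw [val_dintegral ht, val_dintegral (by rwa [← hbound]),
    ← he.integral_comp' (g := fun b => (F b).val)]

theorem dintegral_swap [SFinite μ] [SFinite ν] {F : A → B → DominatedComplex}
    (hF : Measurable fun p : A × B => F p.1 p.2) :
    (dintegral μ fun a => dintegral ν fun b => F a b)
      = dintegral ν fun b => dintegral μ fun a => F a b := by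
  rw [← dintegral_prod (F := fun p : A × B => F p.1 p.2) hF,
    ← dintegral_comp (e := MeasurableEquiv.prodComm)
      (Measure.measurePreserving_swap (μ := ν) (ν := μ))]
  exact dintegral_prod (F := fun p : B × A => F p.2 p.1) (hF.comp measurable_swap)

theorem dintegral_const_mul₂ [SFinite ν] (c : DominatedComplex) {F : A → B → DominatedComplex}
    (hF : Measurable fun p : A × B => F p.1 p.2) :
    (dintegral μ fun a => dintegral ν fun b => c * F a b)
      = c * dintegral μ fun a => dintegral ν fun b => F a b := by
  rw [← dintegral_const_mul μ c (measurable_dintegral hF)]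
  exact dintegral_congr fun a =>
    dintegral_const_mul ν c (hF.comp (by fun_prop : Measurable fun b => (a, b)))

theorem dintegral_mul_dintegral {F : A → DominatedComplex} {G : B → DominatedComplex}
    (hF : Measurable F) (hG : Measurable G) :
    dintegral μ F * dintegral ν G = dintegral μ fun a => dintegral ν fun b => F a * G b := by
  rw [← dintegral_mul_const μ _ hF]
  exact dintegral_congr fun a => (dintegral_const_mul ν _ hG).symm

theorem dintegral_rotate {C : Type*} [MeasurableSpace C] {η : Measure C} [SFinite μ] [SFinite ν]
    [SFinite η] {F : A → B → C → DominatedComplex}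
    (hF : Measurable fun p : A × B × C => F p.1 p.2.1 p.2.2) :
    (dintegral μ fun a => dintegral ν fun b => dintegral η fun c => F a b c)
      = dintegral ν fun b => dintegral η fun c => dintegral μ fun a => F a b c := by
  rw [dintegral_swap (measurable_dintegral (F := fun (p : A × B) c => F p.1 p.2 c)
    (hF.comp (by fun_prop : Measurable fun p : (A × B) × C => (p.1.1, p.1.2, p.2))))]
  exact dintegral_congr fun b => dintegral_swap
    (hF.comp (by fun_prop : Measurable fun p : A × C => (p.1, b, p.2)))

theorem dintegral_unique [Unique A] (μ : Measure A) [IsProbabilityMeasure μ]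
    (F : A → DominatedComplex) : dintegral μ F = F default := by
  have hbound : ∫⁻ a, (F a).bound ∂μ = (F default).bound := by
    rw [lintegral_unique]; simp
  refine ext_of_ne_top hbound fun ht => ?_
  rw [val_dintegral ht, integral_unique]; simp

theorem dintegral_fin_zero (F : (Fin 0 → ℝ) → DominatedComplex) : ∫ᵈ x, F x = F default := by
  rw [volume_pi, Measure.pi_of_empty _ default]
  exact (dintegral_unique _ F).trans (congrArg F (Subsingleton.elim _ _))

theorem dintegral_fin_succ {n : ℕ} {F : (Fin (n + 1) → ℝ) → DominatedComplex}
    (hF : Measurable F) :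
    ∫ᵈ x, F x = ∫ᵈ t, ∫ᵈ (x : Fin n → ℝ), F (Fin.cons t x) := by
  set e := (MeasurableEquiv.piFinSuccAbove (fun _ : Fin (n + 1) => ℝ) 0).symm
  have he : ∀ p, e p = Fin.cons p.1 p.2 := fun p => by
    simp [e, MeasurableEquiv.piFinSuccAbove, Fin.consEquiv]
  have hFe : Measurable fun p : ℝ × (Fin n → ℝ) => F (Fin.cons p.1 p.2) := by
    simp only [← he]
    exact hF.comp e.measurable
  rw [← dintegral_comp (volume_preserving_piFinSuccAbove (fun _ : Fin (n + 1) => ℝ) 0).symm,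
    dintegral_congr fun p => congrArg F (he p)]
  exact dintegral_prod hFe

theorem dintegral_fin_prod {n : ℕ} {f : Fin n → ℝ → DominatedComplex}
    (hf : ∀ j, Measurable (f j)) :
    ∫ᵈ (x : Fin n → ℝ), ∏ j, f j (x j) = ∏ j, ∫ᵈ t, f j t := by
  induction n with
  | zero => simp [dintegral_fin_zero]
  | succ n ih =>
    rw [dintegral_fin_succ (by fun_prop)]
    simp only [Fin.prod_univ_succ, Fin.cons_zero, Fin.cons_succ]
    rw [← dintegral_mul_const _ _ (hf 0)]
    refine dintegral_congr fun t => ?_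
    rw [dintegral_const_mul _ _ (by fun_prop), ih fun j => hf j.succ]

theorem dintegral_sub_left (L : ℝ) (F : ℝ → DominatedComplex) :
    ∫ᵈ t, F (L - t) = ∫ᵈ t, F t :=
  dintegral_comp (e := MeasurableEquiv.subLeft L) (Measure.measurePreserving_sub_left volume L) F

theorem dintegral_add_right (L : ℝ) (F : ℝ → DominatedComplex) :
    ∫ᵈ t, F (t + L) = ∫ᵈ t, F t :=
  dintegral_comp (e := MeasurableEquiv.addRight L) (measurePreserving_add_right volume L) F

theorem dintegral_restrict {s : Set A} (h : ∀ a ∉ s, F a = 0) :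
    dintegral (μ.restrict s) F = dintegral μ F := by
  have hbound : ∫⁻ a in s, (F a).bound ∂μ = ∫⁻ a, (F a).bound ∂μ :=
    setLIntegral_eq_of_support_subset (fun a ha => by_contra fun has => ha (by simp [h a has]))
  refine ext_of_ne_top hbound fun ht => ?_
  rw [val_dintegral ht, val_dintegral (by rwa [← hbound])]
  exact setIntegral_eq_integral_of_forall_compl_eq_zero fun a ha => by simp [h a ha]

theorem dintegral_substitution {f f' : ℝ → ℝ} (hf' : ∀ t, HasDerivAt f (f' t) t)
    (hf : f.Injective) {F : ℝ → DominatedComplex} (hF : ∀ x ∉ Set.range f, F x = 0) :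
    ∫ᵈ x, F x = ∫ᵈ t, of (|f' t| : ℝ) * F (f t) := by
  have hf'w : ∀ t ∈ Set.univ, HasDerivWithinAt f (f' t) Set.univ t :=
    fun t _ => (hf' t).hasDerivWithinAt
  have hbound : ∫⁻ x in Set.range f, (F x).bound = ∫⁻ t, (of (|f' t| : ℝ) * F (f t)).bound := by
    rw [← Set.image_univ, lintegral_image_eq_lintegral_abs_deriv_mul .univ hf'w hf.injOn,
      Measure.restrict_univ]
    refine lintegral_congr fun t => ?_
    rw [bound_mul, bound_of, ← ofReal_norm, Complex.norm_real, Real.norm_eq_abs, abs_abs]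
  rw [← dintegral_restrict hF]
  refine ext_of_ne_top hbound fun ht => ?_
  rw [val_dintegral ht, val_dintegral (by rwa [← hbound]), ← Set.image_univ,
    integral_image_eq_integral_abs_deriv_smul .univ hf'w hf.injOn, Measure.restrict_univ]
  rfl

/-- `d` represents the complex number `v`: its value is `v` as soon as its bound is finite. -/
def Represents (d : DominatedComplex) (v : ℂ) : Prop := d.bound ≠ ∞ → d.val = v

theorem represents_of (z : ℂ) : (of z).Represents z := fun _ => rfl

theorem Represents.mul {d e : DominatedComplex} {v w : ℂ} (h : d.Represents v)
    (h' : e.Represents w) : (d * e).Represents (v * w) := by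
  intro ht
  rw [val_mul]
  by_cases hd : d.bound = ∞
  · have he : e.bound = 0 := by
      by_contra he
      exact ht (by rw [bound_mul, hd, ENNReal.top_mul he])
    rw [← h' (by simp [he]), val_eq_zero_of_bound he, mul_zero, mul_zero]
  by_cases he : e.bound = ∞
  · have hd0 : d.bound = 0 := by
      by_contra hd0
      exact ht (by rw [bound_mul, he, ENNReal.mul_top hd0])
    rw [← h hd, val_eq_zero_of_bound hd0, zero_mul, zero_mul]
  rw [h hd, h' he]

theorem ae_val_eq {f : A → ℂ} (hF : Measurable F) (h : ∀ a, (F a).Represents (f a))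
    (ht : (dintegral μ F).bound ≠ ∞) : ∀ᵐ a ∂μ, (F a).val = f a := by
  filter_upwards [ae_lt_top (measurable_bound.comp hF) ht] with a ha
  exact h a ha.ne

theorem Represents.dintegral {f : A → ℂ} (hF : Measurable F)
    (h : ∀ a, (F a).Represents (f a)) : (dintegral μ F).Represents (∫ a, f a ∂μ) := by
  intro ht
  rw [val_dintegral ht]
  exact integral_congr_ae (ae_val_eq hF h ht)

theorem integrable_of_represents {f : A → ℂ} (hF : Measurable F)
    (h : ∀ a, (F a).Represents (f a)) (ht : (DominatedComplex.dintegral μ F).bound ≠ ∞) :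
    Integrable f μ :=
  (integrable_val hF ht).congr (ae_val_eq hF h ht)

theorem bound_ne_top_and_val_of_mul_eq {d e f : DominatedComplex} (h : d * e = f)
    (hf : f.bound ≠ ∞) (hval : d.val ≠ 0) : e.bound ≠ ∞ ∧ e.val = f.val / d.val := by
  subst h
  have hbound : d.bound ≠ 0 := mt val_eq_zero_of_bound hval
  refine ⟨fun he => hf (by rw [bound_mul, he, ENNReal.mul_top hbound]), ?_⟩
  rw [val_mul, mul_div_cancel_left₀ _ hval]

end DominatedComplex

open DominatedComplex

/-- The complex exponential as a dominated complex number. -/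
def dexp (t : ℂ) : DominatedComplex := of (Complex.exp t)

@[fun_prop] theorem measurable_dexp : Measurable dexp := by unfold dexp; fun_prop

theorem dexp_add (s t : ℂ) : dexp (s + t) = dexp s * dexp t := by
  rw [dexp, Complex.exp_add, of_mul]; rfl

@[simp] theorem dexp_zero : dexp 0 = 1 := by simp [dexp]

theorem dexp_sum {ι : Type*} (s : Finset ι) (f : ι → ℂ) :
    dexp (∑ i ∈ s, f i) = ∏ i ∈ s, dexp (f i) := by
  classical
  induction s using Finset.induction_on with
  | empty => simp
  | insert i s hi ih => rw [Finset.sum_insert hi, Finset.prod_insert hi, dexp_add, ih]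

/-- The complex power of the positive part of a real number; it vanishes on `(-∞, 0]` for every
exponent. -/
def posCpow (x : ℝ) (s : ℂ) : ℂ := if 0 < x then Complex.exp (s * Real.log x) else 0

@[fun_prop] theorem measurable_posCpow (s : ℂ) : Measurable fun x => posCpow x s :=
  Measurable.ite (measurableSet_lt measurable_const measurable_id) (by fun_prop) measurable_const

theorem posCpow_of_pos {x : ℝ} (h : 0 < x) (s : ℂ) :
    posCpow x s = Complex.exp (s * Real.log x) := if_pos h

theorem posCpow_of_nonpos {x : ℝ} (h : x ≤ 0) (s : ℂ) : posCpow x s = 0 := if_neg h.not_gt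

theorem posCpow_exp (t : ℝ) (s : ℂ) : posCpow (Real.exp t) s = Complex.exp (s * t) := by
  rw [posCpow_of_pos (Real.exp_pos t), Real.log_exp]

@[simp] theorem posCpow_one_left (s : ℂ) : posCpow 1 s = 1 := by simp [posCpow]

theorem posCpow_add (x : ℝ) (s t : ℂ) : posCpow x (s + t) = posCpow x s * posCpow x t := by
  unfold posCpow
  split_ifs
  · rw [add_mul, Complex.exp_add]
  · simp

theorem posCpow_mul {x : ℝ} (hx : 0 < x) (y : ℝ) (s : ℂ) :
    posCpow (x * y) s = posCpow x s * posCpow y s := by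
  by_cases hy : 0 < y
  · rw [posCpow_of_pos hx, posCpow_of_pos hy, posCpow_of_pos (mul_pos hx hy),
      Real.log_mul hx.ne' hy.ne', ← Complex.exp_add]
    push_cast
    ring_nf
  · rw [not_lt] at hy
    rw [posCpow_of_nonpos hy, posCpow_of_nonpos (mul_nonpos_of_nonneg_of_nonpos hx.le hy),
      mul_zero]

theorem posCpow_eq_cpow {x : ℝ} (hx : 0 < x) (s : ℂ) : posCpow x s = (x : ℂ) ^ s := by
  rw [posCpow_of_pos hx, Complex.cpow_def_of_ne_zero (by exact_mod_cast hx.ne'),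
    Complex.ofReal_log hx.le, mul_comm]

/-- The integrand of the Bessel integral, as a function of `t`. -/
def besselWeight (c : ℂ) (A B t : ℝ) : DominatedComplex :=
  dexp (c * t - (A * Real.exp (-t) + B * Real.exp t : ℝ))

@[fun_prop] theorem measurable_besselWeight (c : ℂ) (A B : ℝ) :
    Measurable (besselWeight c A B) := by
  unfold besselWeight; fun_prop

theorem besselWeight_mul (c c' : ℂ) (A A' B B' t : ℝ) :
    besselWeight c A B t * besselWeight c' A' B' t
      = besselWeight (c + c') (A + A') (B + B') t := by
  rw [besselWeight, besselWeight, besselWeight, ← dexp_add]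
  congr 1
  push_cast
  ring

theorem besselWeight_zero_left (c : ℂ) (B t : ℝ) :
    besselWeight c 0 B t = dexp (c * t) * dexp (-(B * Real.exp t : ℝ)) := by
  rw [besselWeight, ← dexp_add, zero_mul, zero_add, sub_eq_add_neg]

/-- The Bessel (Macdonald) function `∫ exp (c t - A e⁻ᵗ - B eᵗ) dt`. -/
def besselIntegral (c : ℂ) (A B : ℝ) : DominatedComplex := ∫ᵈ t, besselWeight c A B t

/-- The Gamma function, as Euler's integral in the variable `log y`. -/
def dGamma (s : ℂ) : DominatedComplex := besselIntegral s 0 1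

theorem besselIntegral_reflect (c : ℂ) (A B L : ℝ) :
    besselIntegral c A B
      = dexp (c * L) * besselIntegral (-c) (B * Real.exp L) (A * Real.exp (-L)) := by
  rw [besselIntegral, besselIntegral, ← dintegral_sub_left L,
    ← dintegral_const_mul _ _ (by fun_prop)]
  refine dintegral_congr fun t => ?_
  rw [besselWeight, besselWeight, ← dexp_add, show -(L - t) = -L + t by ring,
    sub_eq_add_neg L t, Real.exp_add, Real.exp_add]
  congr 1
  push_cast
  ring

theorem besselIntegral_neg (c : ℂ) {A B : ℝ} (hA : 0 < A) (hB : 0 < B) :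
    besselIntegral c A B
      = dexp (c * (Real.log A - Real.log B)) * besselIntegral (-c) A B := by
  rw [besselIntegral_reflect c A B (Real.log A - Real.log B), neg_sub, Real.exp_sub, Real.exp_sub,
    Real.exp_log hA, Real.exp_log hB, mul_div_cancel₀ _ hB.ne', mul_div_cancel₀ _ hA.ne',
    Complex.ofReal_sub]

theorem besselIntegral_zero_right (s : ℂ) {A : ℝ} (hA : 0 < A) :
    besselIntegral (-s) A 0 = dexp (-s * Real.log A) * dGamma s := by
  rw [besselIntegral_reflect (-s) A 0 (Real.log A), Real.exp_neg, Real.exp_log hA, zero_mul,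
    mul_inv_cancel₀ hA.ne', neg_neg, dGamma]

theorem besselIntegral_zero_left (s : ℂ) {B : ℝ} (hB : 0 < B) :
    besselIntegral s 0 B = dexp (-s * Real.log B) * dGamma s := by
  rw [← besselIntegral_zero_right s hB, besselIntegral_reflect s 0 B 0]
  simp

theorem dGamma_eq_dintegral_Ioi (s : ℂ) :
    dGamma s = dintegral (volume.restrict (Set.Ioi 0)) fun y : ℝ =>
      of ((Real.exp (-y) : ℝ) * (y : ℂ) ^ (s - 1)) := by
  have hzero : ∀ y ∉ Set.Ioi (0 : ℝ), of ((Real.exp (-y) : ℝ) * posCpow y (s - 1)) = 0 :=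
    fun y hy => by simp [posCpow_of_nonpos (not_lt.1 hy)]
  have hpos : ∀ᵐ y ∂volume.restrict (Set.Ioi (0 : ℝ)),
      of ((Real.exp (-y) : ℝ) * (y : ℂ) ^ (s - 1))
        = of ((Real.exp (-y) : ℝ) * posCpow y (s - 1)) :=
    (ae_restrict_mem measurableSet_Ioi).mono fun y hy => by rw [posCpow_eq_cpow hy]
  rw [dintegral_congr_ae hpos, dintegral_restrict hzero,
    dintegral_substitution Real.hasDerivAt_exp Real.exp_injective (by rwa [Real.range_exp])]
  refine dintegral_congr fun t => ?_
  rw [← of_mul, posCpow_exp, abs_of_pos (Real.exp_pos t), besselWeight, dexp, Complex.ofReal_exp,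
    Complex.ofReal_exp, ← Complex.exp_add, ← Complex.exp_add]
  congr 2
  push_cast
  ring

theorem bound_dGamma_ne_top {s : ℂ} (hs : 0 < s.re) : (dGamma s).bound ≠ ∞ := by
  rw [dGamma_eq_dintegral_Ioi]
  exact (Complex.GammaIntegral_convergent hs).2.ne

theorem val_dGamma {s : ℂ} (hs : 0 < s.re) : (dGamma s).val = Complex.Gamma s := by
  rw [dGamma_eq_dintegral_Ioi, val_dintegral (Complex.GammaIntegral_convergent hs).2.ne,
    Complex.Gamma_eq_integral hs, Complex.GammaIntegral]
  rfl

theorem val_dGamma_ne_zero {s : ℂ} (hs : 0 < s.re) : (dGamma s).val ≠ 0 := by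
  rw [val_dGamma hs]
  exact Complex.Gamma_ne_zero_of_re_pos hs

theorem exp_add_log_one_add_mul_exp_neg {b t : ℝ} (h : 0 < 1 + b * Real.exp (-t)) :
    Real.exp (t + Real.log (1 + b * Real.exp (-t))) = Real.exp t + b := by
  rw [Real.exp_add, Real.exp_log h, mul_one_add, mul_left_comm, ← Real.exp_add, add_neg_cancel,
    Real.exp_zero, mul_one]

theorem dintegral_log_exp_add {b : ℝ} (hb : 0 < b) {F : ℝ → DominatedComplex}
    (hF : ∀ x, Real.exp x ≤ b → F x = 0) :
    ∫ᵈ x, F x = ∫ᵈ t, dexp (-Real.log (1 + b * Real.exp (-t)))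
      * F (t + Real.log (1 + b * Real.exp (-t))) := by
  set f : ℝ → ℝ := fun t => t + Real.log (1 + b * Real.exp (-t))
  have hpos (t : ℝ) : 0 < 1 + b * Real.exp (-t) := by positivity
  have hexp (t : ℝ) : Real.exp (f t) = Real.exp t + b := exp_add_log_one_add_mul_exp_neg (hpos t)
  have hinj : f.Injective := fun s t h =>
    Real.exp_injective (add_right_cancel (by rw [← hexp, h, hexp] : Real.exp s + b = _))
  have hder (t : ℝ) : HasDerivAt f (1 + b * Real.exp (-t))⁻¹ t := by
    have h := (hasDerivAt_id t).add
      ((((hasDerivAt_neg t).exp.const_mul b).const_add 1).log (hpos t).ne')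
    refine h.congr_deriv ?_
    have := (hpos t).ne'
    field_simp
    ring
  have hzero : ∀ x ∉ Set.range f, F x = 0 := fun x hx => hF x <| by
    by_contra! h
    refine hx ⟨Real.log (Real.exp x - b), Real.exp_injective ?_⟩
    rw [hexp, Real.exp_log (by linarith), sub_add_cancel]
  rw [dintegral_substitution hder hinj hzero]
  refine dintegral_congr fun t => ?_
  rw [abs_of_pos (inv_pos.2 (hpos t)), dexp, ← Complex.ofReal_neg, ← Complex.ofReal_exp,
    Real.exp_neg (Real.log _), Real.exp_log (hpos t)]

theorem dintegral_besselWeight_mul_tail (c : ℂ) (B z : ℝ) :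
    ∫ᵈ t, besselWeight c 0 B t * of (posCpow (1 - Real.exp (z - t)) (c - 1))
      = besselIntegral c 0 B * dexp (-(B * Real.exp z : ℝ)) := by
  have hzero (t : ℝ) (ht : Real.exp t ≤ Real.exp z) :
      besselWeight c 0 B t * of (posCpow (1 - Real.exp (z - t)) (c - 1)) = 0 := by
    rw [posCpow_of_nonpos (by simpa using ht), of_zero, mul_zero]
  rw [dintegral_log_exp_add (Real.exp_pos z) hzero, besselIntegral,
    ← dintegral_mul_const _ _ (by fun_prop)]
  refine dintegral_congr fun t => ?_
  rw [← Real.exp_add, ← sub_eq_add_neg]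
  set p := 1 + Real.exp (z - t) with hp
  have hp0 : 0 < p := by positivity
  have htail : 1 - Real.exp (z - (t + Real.log p)) = Real.exp (-Real.log p) := by
    rw [← sub_sub, sub_eq_add_neg (z - t), Real.exp_add, Real.exp_neg, Real.exp_log hp0]
    field_simp
    rw [hp, add_sub_cancel_right]
  have hexp : Real.exp (t + Real.log p) = Real.exp t + Real.exp z := by
    rw [Real.exp_add, Real.exp_log hp0, hp, mul_one_add, ← Real.exp_add, add_sub_cancel]
  rw [htail, posCpow_exp, besselWeight, besselWeight, hexp, ← dexp, ← dexp_add, ← dexp_add,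
    ← dexp_add]
  congr 1
  push_cast
  ring

/-- The Beta function, as Euler's integral in the variable `log τ`. -/
def dBeta (c e : ℂ) : DominatedComplex :=
  ∫ᵈ (t : ℝ), dexp (e * t) * of (posCpow (1 - Real.exp t) (c - 1))

theorem dGamma_mul_dGamma (c e : ℂ) : dGamma c * dGamma e = dGamma (c + e) * dBeta c e := by
  calc dGamma c * dGamma e
      = ∫ᵈ (z : ℝ), ∫ᵈ (t : ℝ), dexp (e * z) * (besselWeight c 0 1 t
          * of (posCpow (1 - Real.exp (z - t)) (c - 1))) := by
        simp only [dGamma]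
        rw [besselIntegral.eq_1 e, ← dintegral_const_mul _ _ (by fun_prop)]
        refine dintegral_congr fun z => ?_
        rw [dintegral_const_mul _ _ (by fun_prop), dintegral_besselWeight_mul_tail,
          besselWeight_zero_left]
        ac_rfl
    _ = ∫ᵈ (t : ℝ), ∫ᵈ (z : ℝ), dexp (e * z) * (besselWeight c 0 1 t
          * of (posCpow (1 - Real.exp (z - t)) (c - 1))) := dintegral_swap (by fun_prop)
    _ = ∫ᵈ (t : ℝ), besselWeight (c + e) 0 1 t * dBeta c e := by
        refine dintegral_congr fun t => ?_
        rw [← dintegral_add_right t, dBeta, ← dintegral_const_mul _ _ (by fun_prop)]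
        refine dintegral_congr fun z => ?_
        rw [add_sub_cancel_right, besselWeight_zero_left, besselWeight_zero_left,
          Complex.ofReal_add, mul_add, dexp_add, add_mul, dexp_add]
        ac_rfl
    _ = dGamma (c + e) * dBeta c e := dintegral_mul_const _ _ (by fun_prop)

/-- The Riemann–Liouville transform `∫ (q - x)^(c-1) k x dx` over `x < q`, up to the factor
`Γ c`. -/
def riemannLiouville (c : ℂ) (k : ℝ → ℂ) (q : ℝ) : DominatedComplex :=
  ∫ᵈ x, of (posCpow (q - x) (c - 1) * k x)

@[fun_prop] theorem measurable_riemannLiouville (c : ℂ) {k : ℝ → ℂ} (hk : Measurable k) :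
    Measurable (riemannLiouville c k) := by
  unfold riemannLiouville
  fun_prop

theorem riemannLiouville_eq_posCpow_mul (c : ℂ) {k : ℝ → ℂ} (hk : Measurable k)
    (hk0 : ∀ x ≤ 0, k x = 0) (q : ℝ) :
    riemannLiouville c k q = of (posCpow q c)
      * ∫ᵈ (t : ℝ), dexp t * of (posCpow (1 - Real.exp t) (c - 1) * k (q * Real.exp t)) := by
  rcases le_or_gt q 0 with hq | hq
  · rw [posCpow_of_nonpos hq, of_zero, zero_mul, ← dintegral_zero (volume : Measure ℝ)]
    refine dintegral_congr fun x => ?_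
    rcases le_or_gt x 0 with hx | hx
    · simp [hk0 x hx]
    · simp [posCpow_of_nonpos (by linarith : q - x ≤ 0)]
  have hinj : Function.Injective fun t => q * Real.exp t := fun s t h =>
    Real.exp_injective (mul_left_cancel₀ hq.ne' h)
  have hzero : ∀ x ∉ Set.range fun t => q * Real.exp t,
      of (posCpow (q - x) (c - 1) * k x) = 0 := fun x hx => by
    rw [hk0, mul_zero, of_zero]
    by_contra! hx0
    exact hx ⟨Real.log (x / q), by
      simp only [Real.exp_log (div_pos hx0 hq)]; field_simp⟩
  rw [riemannLiouville,
    dintegral_substitution (fun t => (Real.hasDerivAt_exp t).const_mul q) hinj hzero,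
    ← dintegral_const_mul _ _ (by fun_prop)]
  refine dintegral_congr fun t => ?_
  have hq1 : posCpow q c = q * posCpow q (c - 1) := by
    nth_rw 1 [← add_sub_cancel 1 c]
    rw [posCpow_add, posCpow_of_pos hq 1, one_mul, ← Complex.ofReal_exp, Real.exp_log hq]
  rw [abs_of_pos (by positivity), ← mul_one_sub, posCpow_mul hq, hq1, dexp, ← of_mul, ← of_mul,
    ← of_mul]
  congr 1
  push_cast
  ring

theorem riemannLiouville_posCpow (c e : ℂ) (q : ℝ) :
    riemannLiouville c (fun x => posCpow x (e - 1)) q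
      = of (posCpow q (c + e - 1)) * dBeta c e := by
  rw [riemannLiouville_eq_posCpow_mul c (by fun_prop) fun x hx => posCpow_of_nonpos hx _]
  rcases le_or_gt q 0 with hq | hq
  · simp [posCpow_of_nonpos hq]
  rw [add_sub_assoc, posCpow_add, of_mul, mul_assoc, dBeta,
    ← dintegral_const_mul _ (of (posCpow q (e - 1))) (by fun_prop)]
  refine congrArg _ (dintegral_congr fun t => ?_)
  rw [posCpow_mul hq, posCpow_exp, dexp, dexp, ← of_mul, ← of_mul, ← of_mul,
    show e * t = t + (e - 1) * t by ring, Complex.exp_add]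
  congr 1
  ring

theorem riemannLiouville_one_sub_mul {a b : ℝ} (ha : 0 < a) (hb : 0 ≤ b) (c : ℂ) {k : ℝ → ℂ}
    (hk : Measurable k) :
    riemannLiouville c k (1 - a * b) = dexp (c * Real.log a) * ∫ᵈ (t : ℝ), dexp (-c * t)
      * of (posCpow (1 - b * Real.exp t) (c - 1) * k (1 - a * Real.exp (-t))) := by
  set f : ℝ → ℝ := fun t => 1 - a * Real.exp (-t)
  have hder (t : ℝ) : HasDerivAt f (a * Real.exp (-t)) t :=
    (((hasDerivAt_neg t).exp.const_mul a).const_sub 1).congr_deriv (by ring)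
  have hinj : f.Injective := fun s t h =>
    neg_injective (Real.exp_injective (mul_left_cancel₀ ha.ne' (sub_right_injective h)))
  have hzero : ∀ x ∉ Set.range f, of (posCpow (1 - a * b - x) (c - 1) * k x) = 0 :=
    fun x hx => by
      rw [posCpow_of_nonpos, zero_mul, of_zero]
      by_contra! h
      have hx1 : 0 < (1 - x) / a := div_pos (by nlinarith) ha
      refine hx ⟨-Real.log ((1 - x) / a), ?_⟩
      simp only [f, neg_neg, Real.exp_log hx1]
      field_simp
      ring
  rw [riemannLiouville, dintegral_substitution hder hinj hzero,
    ← dintegral_const_mul _ _ (by fun_prop)]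
  refine dintegral_congr fun t => ?_
  have hfactor : 1 - a * b - f t = Real.exp (Real.log a - t) * (1 - b * Real.exp t) := by
    rw [Real.exp_sub, Real.exp_log ha]
    simp only [f, Real.exp_neg]
    field_simp
    ring
  have hscale : a * Real.exp (-t) = Real.exp (Real.log a - t) := by
    rw [sub_eq_add_neg, Real.exp_add, Real.exp_log ha]
  have hvalue : k (f t) = k (1 - Real.exp (Real.log a - t)) := by rw [← hscale]
  rw [hfactor, posCpow_mul (Real.exp_pos _), posCpow_exp, hvalue, hscale,
    abs_of_pos (Real.exp_pos _), dexp, dexp, ← of_mul, ← of_mul, ← of_mul, Complex.ofReal_exp]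
  simp only [← mul_assoc, ← Complex.exp_add]
  congr 4
  push_cast
  ring

theorem besselIntegral_mul_dintegral_besselWeight {a : ℝ} (ha : 0 < a) (B : ℝ) (c : ℂ)
    {k : ℝ → ℂ} (hk : Measurable k) :
    besselIntegral c 0 B * ∫ᵈ (z : ℝ), besselWeight (-c) 0 B z * of (k (1 - a * Real.exp (-z)))
      = dexp (-c * Real.log a)
        * ∫ᵈ (t : ℝ), besselWeight c 0 B t * riemannLiouville c k (1 - a * Real.exp (-t)) := by
  calc _ = ∫ᵈ (z : ℝ), ∫ᵈ (t : ℝ), besselWeight c 0 B t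
          * of (posCpow (1 - Real.exp (z - t)) (c - 1))
          * (dexp (-c * z) * of (k (1 - a * Real.exp (-z)))) := by
        rw [← dintegral_const_mul _ _ (by fun_prop)]
        refine dintegral_congr fun z => ?_
        rw [dintegral_mul_const _ _ (by fun_prop), dintegral_besselWeight_mul_tail,
          besselWeight_zero_left]
        ac_rfl
    _ = ∫ᵈ (t : ℝ), ∫ᵈ (z : ℝ), besselWeight c 0 B t * of (posCpow (1 - Real.exp (z - t)) (c - 1))
          * (dexp (-c * z) * of (k (1 - a * Real.exp (-z)))) := dintegral_swap (by fun_prop)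
    _ = ∫ᵈ (t : ℝ), dexp (-c * Real.log a)
          * (besselWeight c 0 B t * riemannLiouville c k (1 - a * Real.exp (-t))) := by
        refine dintegral_congr fun t => ?_
        rw [riemannLiouville_one_sub_mul ha (Real.exp_pos _).le c hk,
          mul_left_comm (besselWeight ..), ← mul_assoc (dexp _), ← dexp_add, neg_mul,
          neg_add_cancel, dexp_zero, one_mul, ← dintegral_const_mul _ _ (by fun_prop)]
        refine dintegral_congr fun z => ?_
        rw [of_mul, neg_mul, ← Real.exp_add, neg_add_eq_sub]
        ac_rfl
    _ = _ := dintegral_const_mul _ _ (by fun_prop)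

open Finset

variable {m n p : ℕ}

/-- The coordinates of a finite sequence, continued by `0`. -/
def coord (y : Fin m → ℝ) (j : ℕ) : ℝ := if h : j < m then y ⟨j, h⟩ else 0

/-- The exponentials of the coordinates of a finite sequence, continued by `0`, which is the
value at `y j = -∞`. -/
def expCoord (y : Fin m → ℝ) (j : ℕ) : ℝ := if h : j < m then Real.exp (y ⟨j, h⟩) else 0

/-- The exponentials `exp (-y j)`, continued by `0`, which is the value at `y j = ∞`. -/
def expNegCoord (y : Fin m → ℝ) (j : ℕ) : ℝ := if h : j < m then Real.exp (-y ⟨j, h⟩) else 0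

theorem expCoord_of_lt (y : Fin m → ℝ) {j : ℕ} (h : j < m) :
    expCoord y j = Real.exp (coord y j) := by
  simp [expCoord, coord, h]

theorem expNegCoord_of_lt (y : Fin m → ℝ) {j : ℕ} (h : j < m) :
    expNegCoord y j = Real.exp (-coord y j) := by
  simp [expNegCoord, coord, h]

theorem coord_of_le (y : Fin m → ℝ) {j : ℕ} (h : m ≤ j) : coord y j = 0 := dif_neg h.not_gt

theorem expCoord_of_le (y : Fin m → ℝ) {j : ℕ} (h : m ≤ j) : expCoord y j = 0 := dif_neg h.not_gt

theorem expNegCoord_of_le (y : Fin m → ℝ) {j : ℕ} (h : m ≤ j) : expNegCoord y j = 0 :=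
  dif_neg h.not_gt

@[simp] theorem coord_fin (y : Fin m → ℝ) (j : Fin m) : coord y j = y j := by simp [coord]

@[simp] theorem expCoord_fin (y : Fin m → ℝ) (j : Fin m) : expCoord y j = Real.exp (y j) := by
  simp [expCoord]

@[simp] theorem expNegCoord_fin (y : Fin m → ℝ) (j : Fin m) :
    expNegCoord y j = Real.exp (-y j) := by
  simp [expNegCoord]

theorem expCoord_castSucc (y : Fin (m + 1) → ℝ) (j : Fin m) :
    expCoord y j = Real.exp (y j.castSucc) := expCoord_fin y j.castSucc

theorem expNegCoord_succ (y : Fin (m + 1) → ℝ) (j : Fin m) :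
    expNegCoord y (j + 1) = Real.exp (-y j.succ) := expNegCoord_fin y j.succ

theorem expCoord_nonneg (y : Fin m → ℝ) (j : ℕ) : 0 ≤ expCoord y j := by
  unfold expCoord; split_ifs <;> positivity

theorem expNegCoord_nonneg (y : Fin m → ℝ) (j : ℕ) : 0 ≤ expNegCoord y j := by
  unfold expNegCoord; split_ifs <;> positivity

@[fun_prop] theorem measurable_expCoord (j : ℕ) :
    Measurable fun y : Fin m → ℝ => expCoord y j := by
  unfold expCoord
  split_ifs <;> fun_prop

@[fun_prop] theorem measurable_expNegCoord (j : ℕ) :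
    Measurable fun y : Fin m → ℝ => expNegCoord y j := by
  unfold expNegCoord
  split_ifs <;> fun_prop

theorem sum_range_coord (y : Fin m → ℝ) (hmn : m ≤ n) : ∑ j ∈ range n, coord y j = ∑ j, y j := by
  rw [← sum_subset (range_subset_range.2 hmn), sum_range]
  · simp
  · intro j _ hj
    exact coord_of_le y (by simpa using hj)

/-- The exponentials of the coordinates, shifted by one place. -/
def expCoordPred (y : Fin m → ℝ) : ℕ → ℝ
  | 0 => 0
  | j + 1 => expCoord y j

/-- The interaction of two interlacing sequences. -/
def interaction (z : Fin n → ℝ) (y : Fin m → ℝ) : ℝ :=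
  ∑ j ∈ range n, (expCoord z j * expNegCoord y j + expCoord y j * expNegCoord z (j + 1))

/-- The common kernel of the raising operator and the Baxter operator of the `GL` Toda chain. -/
def kernel (τ : ℂ) (z : Fin n → ℝ) (y : Fin m → ℝ) : DominatedComplex :=
  dexp (τ * ((∑ j, z j - ∑ j, y j : ℝ) : ℂ) - (interaction z y : ℝ))

/-- The boundary variable `1 - a exp (-y 0)`, equal to `1` if there are no coordinates. -/
def gate (a : ℝ) (y : Fin m → ℝ) : ℝ := 1 - a * expNegCoord y 0

/-- The boundary factor `exp (a exp (-y 0))`. -/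
def wall (a : ℝ) (y : Fin m → ℝ) : DominatedComplex := dexp ((a * expNegCoord y 0 : ℝ) : ℂ)

@[fun_prop] theorem measurable_kernel (τ : ℂ) :
    Measurable fun q : (Fin n → ℝ) × (Fin m → ℝ) => kernel τ q.1 q.2 := by
  unfold kernel interaction
  fun_prop

@[fun_prop] theorem measurable_gate (a : ℝ) : Measurable fun y : Fin m → ℝ => gate a y := by
  unfold gate
  fun_prop

@[fun_prop] theorem measurable_wall (a : ℝ) : Measurable fun y : Fin m → ℝ => wall a y := by
  unfold wall
  fun_prop

theorem kernel_eq_prod_lower (τ : ℂ) (z : Fin n → ℝ) (y : Fin m → ℝ) (h : m ≤ n) :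
    kernel τ z y = dexp (τ * (∑ j, z j : ℝ)) * ∏ j : Fin m,
      besselWeight (-τ) (expCoord z j) (expNegCoord z (j + 1)) (y j) := by
  have hinteraction : interaction z y = ∑ j : Fin m,
      (expCoord z j * Real.exp (-y j) + expNegCoord z (j + 1) * Real.exp (y j)) := by
    rw [interaction, ← sum_subset (range_subset_range.2 h), sum_range]
    · simp only [expCoord_fin, expNegCoord_fin, mul_comm (Real.exp (y _))]
    · intro j _ hj
      have hj : m ≤ j := by simpa using hj
      rw [expCoord_of_le y hj, expNegCoord_of_le y hj, mul_zero, zero_mul, add_zero]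
  simp only [kernel, besselWeight]
  rw [← dexp_sum, ← dexp_add, hinteraction, sum_sub_distrib, ← mul_sum]
  congr 1
  push_cast
  ring

theorem kernel_eq_prod_upper (τ : ℂ) (z : Fin n → ℝ) (y : Fin m → ℝ) :
    kernel τ z y = dexp (-τ * (∑ j, y j : ℝ)) * ∏ j : Fin n,
      besselWeight τ (expCoordPred y j) (expNegCoord y j) (z j) := by
  have hinteraction : interaction z y = ∑ j : Fin n,
      (expCoordPred y j * Real.exp (-z j) + expNegCoord y j * Real.exp (z j)) := by
    cases n with
    | zero => simp [interaction]
    | succ n =>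
      rw [interaction, sum_add_distrib, sum_add_distrib, sum_range,
        sum_range_succ (fun j => expCoord y j * expNegCoord z (j + 1)),
        expNegCoord_of_le z le_rfl, sum_range, add_comm,
        Fin.sum_univ_succ fun j : Fin (n + 1) => expCoordPred y j * Real.exp (-z j)]
      simp [expCoordPred, expNegCoord_succ, mul_comm (Real.exp _)]
  simp only [kernel, besselWeight]
  rw [← dexp_sum, ← dexp_add, hinteraction, sum_sub_distrib, ← mul_sum]
  congr 1
  push_cast
  ring

theorem wall_eq_prod (a : ℝ) (y : Fin m → ℝ) :
    wall a y = ∏ j : Fin m, besselWeight 0 (if (j : ℕ) = 0 then -a else 0) 0 (y j) := by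
  simp only [besselWeight]
  rw [← dexp_sum, wall]
  cases m with
  | zero => simp [expNegCoord]
  | succ m =>
    rw [Fin.sum_univ_succ]
    simp [expNegCoord]

/-- The coefficients at the inverse exponentials of a variable below both `z` and `u`, in the
presence of a wall. -/
def lowerCoeff (a : ℝ) (z : Fin n → ℝ) (u : Fin p → ℝ) (j : ℕ) : ℝ :=
  expCoord z j + (if j = 0 then -a else 0) + expCoord u j

theorem dintegral_kernel_mul_wall_mul_kernel (a : ℝ) (α β : ℂ) (z : Fin n → ℝ) (u : Fin p → ℝ)
    (hn : m ≤ n) (hp : m ≤ p) :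
    ∫ᵈ (y : Fin m → ℝ), kernel α z y * wall a y * kernel β u y
      = dexp (α * (∑ j, z j : ℝ) + β * (∑ j, u j : ℝ)) * ∏ j ∈ range m,
        besselIntegral (-(α + β)) (lowerCoeff a z u j)
          (expNegCoord z (j + 1) + expNegCoord u (j + 1)) := by
  simp only [prod_range, besselIntegral]
  rw [← dintegral_fin_prod fun j => by fun_prop, ← dintegral_const_mul _ _ (by fun_prop)]
  refine dintegral_congr fun y => ?_
  rw [kernel_eq_prod_lower α z y hn, kernel_eq_prod_lower β u y hp, wall_eq_prod,
    mul_assoc (dexp _), mul_mul_mul_comm, ← dexp_add, ← prod_mul_distrib, ← prod_mul_distrib]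
  simp only [besselWeight_mul, lowerCoeff, neg_add, add_zero]

theorem dintegral_kernel_mul_kernel (α β : ℂ) (z : Fin n → ℝ) (y : Fin p → ℝ) (hn : m ≤ n) :
    ∫ᵈ (x : Fin m → ℝ), kernel α z x * kernel β x y
      = dexp (α * (∑ j, z j : ℝ) - β * (∑ j, y j : ℝ)) * ∏ j ∈ range m,
        besselIntegral (β - α) (expCoord z j + expCoordPred y j)
          (expNegCoord z (j + 1) + expNegCoord y j) := by
  simp only [prod_range, besselIntegral]
  rw [← dintegral_fin_prod fun j => by fun_prop, ← dintegral_const_mul _ _ (by fun_prop)]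
  refine dintegral_congr fun x => ?_
  rw [kernel_eq_prod_lower α z x hn, kernel_eq_prod_upper β x y, mul_mul_mul_comm, ← dexp_add,
    ← prod_mul_distrib]
  simp only [besselWeight_mul, neg_add_eq_sub, neg_mul, ← sub_eq_add_neg]

theorem dintegral_kernel_mul_comp_mul_kernel {q : ℕ} (α β : ℂ) (x : Fin p → ℝ) (v : Fin q → ℝ)
    {k : ℝ → DominatedComplex} (hk : Measurable k) :
    ∫ᵈ (z : Fin (m + 1) → ℝ), kernel α z x * k (z 0) * kernel β z v
      = dexp (-α * (∑ j, x j : ℝ) - β * (∑ j, v j : ℝ))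
        * (∫ᵈ (t : ℝ), besselWeight (α + β) 0 (expNegCoord x 0 + expNegCoord v 0) t * k t)
        * ∏ j ∈ range m, besselIntegral (α + β) (lowerCoeff 0 x v j)
          (expNegCoord x (j + 1) + expNegCoord v (j + 1)) := by
  have hweight (z : Fin (m + 1) → ℝ) : kernel α z x * k (z 0) * kernel β z v
      = dexp (-α * (∑ j, x j : ℝ) - β * (∑ j, v j : ℝ))
        * (besselWeight (α + β) 0 (expNegCoord x 0 + expNegCoord v 0) (z 0) * k (z 0)
          * ∏ j : Fin m, besselWeight (α + β) (lowerCoeff 0 x v j)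
            (expNegCoord x (j + 1) + expNegCoord v (j + 1)) (z j.succ)) := by
    rw [kernel_eq_prod_upper, kernel_eq_prod_upper, mul_right_comm, mul_mul_mul_comm, ← dexp_add,
      ← prod_mul_distrib, Fin.prod_univ_succ]
    simp only [besselWeight_mul, lowerCoeff, expCoordPred, neg_zero, ite_self, add_zero, neg_mul,
      Fin.val_zero, Fin.val_succ, ← sub_eq_add_neg]
    ac_rfl
  rw [dintegral_congr hweight, dintegral_const_mul _ _ (by fun_prop),
    dintegral_fin_succ (by fun_prop), mul_assoc]
  simp only [Fin.cons_zero, Fin.cons_succ, prod_range, besselIntegral]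
  rw [← dintegral_fin_prod fun j => by fun_prop, ← dintegral_mul_const _ _ (by fun_prop)]
  exact congrArg _ (dintegral_congr fun t => dintegral_const_mul _ _ (by fun_prop))

theorem prod_besselIntegral_neg {ι : Type*} (s : Finset ι) (c : ℂ) {A B : ι → ℝ}
    (hA : ∀ i ∈ s, 0 < A i) (hB : ∀ i ∈ s, 0 < B i) :
    ∏ i ∈ s, besselIntegral c (A i) (B i)
      = dexp (c * (∑ i ∈ s, (Real.log (A i) - Real.log (B i)) : ℝ))
        * ∏ i ∈ s, besselIntegral (-c) (A i) (B i) := by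
  rw [Complex.ofReal_sum, mul_sum, dexp_sum, ← prod_mul_distrib]
  refine prod_congr rfl fun i hi => ?_
  rw [besselIntegral_neg c (hA i hi) (hB i hi), Complex.ofReal_sub]

theorem log_exp_neg_add_exp_neg (x y : ℝ) :
    Real.log (Real.exp (-x) + Real.exp (-y)) = Real.log (Real.exp x + Real.exp y) - (x + y) := by
  have h : Real.exp (-x) + Real.exp (-y) = (Real.exp x + Real.exp y) / Real.exp (x + y) := by
    rw [Real.exp_neg, Real.exp_neg, Real.exp_add]
    field_simp
    ring
  rw [h, Real.log_div (by positivity) (by positivity), Real.log_exp]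

/-- The boundary interaction of two sequences: `lowerCoeff a x v 0 * exp (-x 0 - v 0)`, continued
to empty sequences. -/
def boundaryCoupling (a : ℝ) (x : Fin n → ℝ) (v : Fin p → ℝ) : ℝ :=
  expNegCoord x 0 + expNegCoord v 0 - a * expNegCoord x 0 * expNegCoord v 0

theorem boundaryCoupling_eq {a : ℝ} (ha : a ≠ 0) (x : Fin n → ℝ) (v : Fin p → ℝ) :
    boundaryCoupling a x v = (1 - gate a x * gate a v) / a := by
  rw [boundaryCoupling, gate, gate]
  field_simp
  ring

theorem boundaryCoupling_zero_pos (x : Fin (m + 1) → ℝ) (v : Fin p → ℝ) :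
    0 < boundaryCoupling 0 x v := by
  rw [boundaryCoupling, expNegCoord_of_lt x m.succ_pos, zero_mul, zero_mul, sub_zero]
  exact add_pos_of_pos_of_nonneg (Real.exp_pos _) (expNegCoord_nonneg v 0)

theorem boundaryCoupling_eq_mul_exp (a : ℝ) (x : Fin n → ℝ) (v : Fin p → ℝ) (hn : 0 < n)
    (hp : 0 < p) :
    boundaryCoupling a x v = lowerCoeff a x v 0 * Real.exp (-(coord x 0 + coord v 0)) := by
  rw [boundaryCoupling, lowerCoeff, if_pos rfl, expNegCoord_of_lt x hn, expNegCoord_of_lt v hp,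
    expCoord_of_lt x hn, expCoord_of_lt v hp, neg_add, Real.exp_add, Real.exp_neg, Real.exp_neg]
  field_simp
  ring

theorem lowerCoeff_pos {a : ℝ} {x : Fin n → ℝ} {v : Fin p → ℝ} (h : 0 < boundaryCoupling a x v)
    {j : ℕ} (hn : j < n) (hp : j < p) : 0 < lowerCoeff a x v j := by
  rcases Nat.eq_zero_or_pos j with rfl | hj
  · rw [boundaryCoupling_eq_mul_exp a x v hn hp] at h
    exact pos_of_mul_pos_left h (Real.exp_pos _).le
  · rw [lowerCoeff, if_neg hj.ne', expCoord_of_lt x hn, expCoord_of_lt v hp]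
    positivity

theorem expNegCoord_add_pos (x : Fin n → ℝ) (v : Fin p → ℝ) {j : ℕ} (h : j < n) :
    0 < expNegCoord x j + expNegCoord v j := by
  rw [expNegCoord_of_lt x h]
  exact add_pos_of_pos_of_nonneg (Real.exp_pos _) (expNegCoord_nonneg v j)

theorem sum_log_lowerCoeff_sub_log {a : ℝ} {x : Fin n → ℝ} {v : Fin p → ℝ}
    (h : 0 < boundaryCoupling a x v) {k : ℕ} (hn : k < n) (hp : k < p) :
    ∑ j ∈ range k, (Real.log (lowerCoeff a x v j)
        - Real.log (expNegCoord x (j + 1) + expNegCoord v (j + 1)))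
      + Real.log (lowerCoeff a x v k)
      = Real.log (boundaryCoupling a x v)
        + (∑ j ∈ range (k + 1), coord x j + ∑ j ∈ range (k + 1), coord v j) := by
  induction k with
  | zero =>
    rw [boundaryCoupling_eq_mul_exp a x v hn hp,
      Real.log_mul (lowerCoeff_pos h hn hp).ne' (Real.exp_ne_zero _), Real.log_exp]
    simp only [range_zero, sum_empty, zero_add, range_one, sum_singleton]
    ring
  | succ k ih =>
    have hlog : Real.log (expNegCoord x (k + 1) + expNegCoord v (k + 1))
        = Real.log (lowerCoeff a x v (k + 1)) - (coord x (k + 1) + coord v (k + 1)) := by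
      rw [lowerCoeff, if_neg k.succ_ne_zero, add_zero, expNegCoord_of_lt x hn,
        expNegCoord_of_lt v hp, expCoord_of_lt x hn, expCoord_of_lt v hp, log_exp_neg_add_exp_neg]
    rw [sum_range_succ, sum_range_succ (coord x), sum_range_succ (coord v), hlog]
    linarith [ih (by omega) (by omega)]

theorem prod_besselIntegral_of_lt {a : ℝ} (c : ℂ) {x : Fin (m + 1) → ℝ} {v : Fin m → ℝ}
    (h : 0 < boundaryCoupling a x v) :
    ∏ j ∈ range m, besselIntegral c (lowerCoeff a x v j)
        (expNegCoord x (j + 1) + expNegCoord v (j + 1))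
      = dexp (c * (Real.log (boundaryCoupling a x v) + (∑ j, x j + ∑ j, v j) : ℝ))
        * ∏ j ∈ range m, besselIntegral (-c) (lowerCoeff a x v j)
          (expNegCoord x (j + 1) + expNegCoord v (j + 1)) := by
  have hlog : ∑ j ∈ range m, (Real.log (lowerCoeff a x v j)
        - Real.log (expNegCoord x (j + 1) + expNegCoord v (j + 1)))
      = Real.log (boundaryCoupling a x v) + (∑ j, x j + ∑ j, v j) := by
    cases m with
    | zero => simp [boundaryCoupling, expNegCoord]
    | succ m =>
      rw [sum_range_succ, expNegCoord_of_lt x (by omega), expNegCoord_of_le v le_rfl, add_zero,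
        Real.log_exp, ← sum_range_coord x le_rfl, ← sum_range_coord v le_rfl,
        sum_range_succ (coord x) (m + 1)]
      linarith [sum_log_lowerCoeff_sub_log h (Nat.lt_succ_of_lt m.lt_succ_self) m.lt_succ_self]
  rw [← hlog]
  exact prod_besselIntegral_neg _ c
    (fun j hj => lowerCoeff_pos h (by have := mem_range.1 hj; omega) (by simpa using hj))
    (fun j hj => expNegCoord_add_pos x v (by simpa using hj))

theorem prod_besselIntegral_of_eq {a : ℝ} (s : ℂ) {x v : Fin (m + 1) → ℝ}
    (h : 0 < boundaryCoupling a x v) :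
    ∏ j ∈ range (m + 1), besselIntegral (-s) (lowerCoeff a x v j)
        (expNegCoord x (j + 1) + expNegCoord v (j + 1))
      = dGamma s * dexp (-s * (Real.log (boundaryCoupling a x v) + (∑ j, x j + ∑ j, v j) : ℝ))
        * ∏ j ∈ range m, besselIntegral s (lowerCoeff a x v j)
          (expNegCoord x (j + 1) + expNegCoord v (j + 1)) := by
  rw [← sum_range_coord x le_rfl, ← sum_range_coord v le_rfl,
    ← sum_log_lowerCoeff_sub_log h m.lt_succ_self m.lt_succ_self, prod_range_succ,
    expNegCoord_of_le x le_rfl, expNegCoord_of_le v le_rfl, add_zero,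
    besselIntegral_zero_right s (lowerCoeff_pos h m.lt_succ_self m.lt_succ_self),
    prod_besselIntegral_neg (range m) (-s)
      (fun j hj => have hjm := mem_range.1 hj; lowerCoeff_pos h (by omega) (by omega))
      (fun j hj => expNegCoord_add_pos x v (by simpa using hj)),
    neg_neg, Complex.ofReal_add, mul_add, dexp_add]
  ac_rfl

theorem dintegral_wall_exchange {a : ℝ} (α β : ℂ) {u z : Fin (m + 1) → ℝ}
    (h : 0 < boundaryCoupling a u z) :
    ∫ᵈ (y : Fin (m + 1) → ℝ), kernel α u y * wall a y * kernel β z y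
      = dGamma (α + β) * dexp (-(α + β) * Real.log (boundaryCoupling a u z))
        * ∫ᵈ (v : Fin m → ℝ), kernel (-β) u v * wall a v * kernel (-α) z v := by
  rw [dintegral_kernel_mul_wall_mul_kernel a α β u z le_rfl le_rfl,
    dintegral_kernel_mul_wall_mul_kernel a (-β) (-α) u z m.le_succ m.le_succ,
    prod_besselIntegral_of_eq _ h, show -(-β + -α) = α + β by ring]
  have hexp : dexp (α * (∑ j, u j : ℝ) + β * (∑ j, z j : ℝ))
        * dexp (-(α + β) * (Real.log (boundaryCoupling a u z) + (∑ j, u j + ∑ j, z j) : ℝ))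
      = dexp (-(α + β) * Real.log (boundaryCoupling a u z))
        * dexp (-β * (∑ j, u j : ℝ) + -α * (∑ j, z j : ℝ)) := by
    rw [← dexp_add, ← dexp_add]
    congr 1
    push_cast
    ring
  rw [mul_assoc (dGamma _), mul_left_comm, ← mul_assoc (dexp _), hexp]
  ac_rfl

theorem dintegral_wall_exchange_of_lt {a : ℝ} (α β : ℂ) {z : Fin (m + 1) → ℝ} {u : Fin m → ℝ}
    (h : 0 < boundaryCoupling a z u) :
    ∫ᵈ (v : Fin m → ℝ), kernel α z v * wall a v * kernel β u v
      = dexp (-(α + β) * Real.log (boundaryCoupling a z u))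
        * ∫ᵈ (v : Fin m → ℝ), kernel (-β) z v * wall a v * kernel (-α) u v := by
  rw [dintegral_kernel_mul_wall_mul_kernel a α β z u m.le_succ le_rfl,
    dintegral_kernel_mul_wall_mul_kernel a (-β) (-α) z u m.le_succ le_rfl,
    prod_besselIntegral_of_lt _ h, show -(-β + -α) = - -(α + β) by ring, ← mul_assoc, ← mul_assoc,
    ← dexp_add, ← dexp_add]
  congr 2
  push_cast
  ring

theorem gate_succ (a : ℝ) (z : Fin (m + 1) → ℝ) : gate a z = 1 - a * Real.exp (-z 0) := by
  rw [gate, ← expNegCoord_fin z 0, Fin.val_zero]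

theorem dGamma_mul_dintegral_besselWeight {a B : ℝ} (ha : 0 < a) (hB : 0 < B) (α β : ℂ) (X V : ℝ)
    {k : ℝ → ℂ} (hk : Measurable k) :
    dGamma (-(α + β)) * dexp ((α + β) * (Real.log B + (X + V) : ℝ)) * (dexp (-α * X - β * V)
        * ∫ᵈ (t : ℝ), besselWeight (α + β) 0 B t * of (k (1 - a * Real.exp (-t))))
      = dexp ((α + β) * Real.log a) * (dexp (- -β * X - -α * V) * ∫ᵈ (t : ℝ),
        besselWeight (-(α + β)) 0 B t
          * riemannLiouville (-(α + β)) k (1 - a * Real.exp (-t))) := by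
  have hexp : dexp ((α + β) * (Real.log B + (X + V) : ℝ)) * dexp (-α * X - β * V)
      = dexp (- -(α + β) * Real.log B) * dexp (- -β * X - -α * V) := by
    rw [← dexp_add, ← dexp_add]
    congr 1
    push_cast
    ring
  have hbessel := besselIntegral_mul_dintegral_besselWeight ha B (-(α + β)) hk
  rw [besselIntegral_zero_left _ hB] at hbessel
  simp only [neg_neg] at hbessel hexp ⊢
  rw [mul_left_comm (dexp ((α + β) * (Real.log a : ℂ))), ← hbessel, mul_assoc (dGamma _),
    ← mul_assoc (dexp _) (dexp _), hexp]
  ac_rfl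

theorem dGamma_mul_dintegral_gate_exchange {a : ℝ} (ha : 0 < a) (α β : ℂ) {k : ℝ → ℂ}
    (hk : Measurable k) (x : Fin (m + 1) → ℝ) (v : Fin m → ℝ) :
    dGamma (-(α + β))
        * ∫ᵈ (z : Fin (m + 1) → ℝ), kernel α z x * of (k (gate a z)) * kernel β z v
      = dexp ((α + β) * Real.log a) * ∫ᵈ (z : Fin (m + 1) → ℝ),
        kernel (-β) z x * riemannLiouville (-(α + β)) k (gate a z) * kernel (-α) z v := by
  have hB := boundaryCoupling_zero_pos x v
  have hbessel := dGamma_mul_dintegral_besselWeight ha hB α β (∑ j, x j) (∑ j, v j) hk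
  simp only [gate_succ]
  rw [dintegral_kernel_mul_comp_mul_kernel α β x v (k := fun t => of (k (1 - a * Real.exp (-t))))
      (by fun_prop),
    dintegral_kernel_mul_comp_mul_kernel (-β) (-α) x v
      (k := fun t => riemannLiouville (-(α + β)) k (1 - a * Real.exp (-t))) (by fun_prop),
    prod_besselIntegral_of_lt _ hB, ← neg_add_rev, ← mul_assoc (dexp ((α + β) * (Real.log a : ℂ)))]
  have hcoupling : boundaryCoupling 0 x v = expNegCoord x 0 + expNegCoord v 0 := by
    simp [boundaryCoupling]
  rw [hcoupling] at hbessel ⊢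
  rw [← hbessel]
  ac_rfl

theorem dintegral_gate_exchange {a : ℝ} (ha : 0 < a) (α β : ℂ) {k : ℝ → ℂ} (hk : Measurable k)
    (x v : Fin m → ℝ) :
    ∫ᵈ (z : Fin (m + 1) → ℝ), kernel α z x * of (k (gate a z)) * kernel β z v
      = dexp ((α + β) * Real.log a) * ∫ᵈ (z : Fin m → ℝ),
        kernel (-β) z x * riemannLiouville (-(α + β)) k (gate a z) * kernel (-α) z v := by
  simp only [gate_succ]
  rw [dintegral_kernel_mul_comp_mul_kernel α β x v (k := fun t => of (k (1 - a * Real.exp (-t))))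
      (by fun_prop)]
  cases m with
  | zero =>
    have hrl := riemannLiouville_one_sub_mul ha le_rfl (-(α + β)) hk
    simp only [mul_zero, sub_zero, zero_mul, posCpow_one_left, one_mul, neg_neg] at hrl
    rw [neg_add_rev] at hrl
    simp only [dintegral_fin_zero, gate, expNegCoord, kernel, interaction, besselWeight_zero_left,
      univ_eq_empty, sum_empty, Complex.ofReal_zero, mul_zero, sub_self, dexp_zero,
      lt_self_iff_false, ↓reduceDIte, add_zero, zero_mul, neg_zero, mul_one, one_mul, range_zero,
      not_lt_zero, prod_empty, sub_zero, neg_add_rev]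
    rw [hrl, ← mul_assoc, ← dexp_add,
      show (α + β) * Real.log a + (-β + -α) * Real.log a = 0 by ring, dexp_zero, one_mul]
  | succ m =>
    have hB := boundaryCoupling_zero_pos x v
    have hbessel := dGamma_mul_dintegral_besselWeight ha hB α β (∑ j, x j) (∑ j, v j) hk
    have hchain := prod_besselIntegral_of_eq (-(α + β)) hB
    rw [neg_neg] at hchain
    simp only [gate_succ]
    rw [dintegral_kernel_mul_comp_mul_kernel (-β) (-α) x v
        (k := fun t => riemannLiouville (-(α + β)) k (1 - a * Real.exp (-t))) (by fun_prop),
      hchain, ← neg_add_rev, ← mul_assoc (dexp ((α + β) * (Real.log a : ℂ)))]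
    have hcoupling : boundaryCoupling 0 x v = expNegCoord x 0 + expNegCoord v 0 := by
      simp [boundaryCoupling]
    rw [hcoupling] at hbessel ⊢
    rw [← hbessel]
    ac_rfl

theorem sum_log_expCoord_sub_log (z : Fin n → ℝ) (y : Fin p → ℝ) {k : ℕ} (hn : k < n)
    (hp : k ≤ p) :
    ∑ j ∈ range k, (Real.log (expCoord z j + expCoordPred y j)
        - Real.log (expNegCoord z (j + 1) + expNegCoord y j))
      + Real.log (expCoord z k + expCoordPred y k)
      = ∑ j ∈ range (k + 1), coord z j + ∑ j ∈ range k, coord y j := by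
  induction k with
  | zero => simp [expCoord_of_lt z hn, expCoordPred]
  | succ k ih =>
    have hlog : Real.log (expNegCoord z (k + 1) + expNegCoord y k)
        = Real.log (expCoord z (k + 1) + expCoordPred y (k + 1))
          - (coord z (k + 1) + coord y k) := by
      rw [expCoordPred, expNegCoord_of_lt z hn, expNegCoord_of_lt y hp, expCoord_of_lt z hn,
        expCoord_of_lt y hp, log_exp_neg_add_exp_neg]
    rw [sum_range_succ, sum_range_succ (coord z), sum_range_succ (coord y), hlog]
    linarith [ih (by omega) (by omega)]

theorem dintegral_kernel_exchange (τ τ' : ℂ) (z : Fin (m + 1) → ℝ) (y : Fin m → ℝ) :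
    ∫ᵈ (x : Fin (m + 1) → ℝ), kernel τ z x * kernel τ' x y
      = dGamma (τ - τ') * ∫ᵈ (x : Fin m → ℝ), kernel τ' z x * kernel τ x y := by
  have hA : ∀ j < m + 1, 0 < expCoord z j + expCoordPred y j := fun j hj => by
    rw [expCoord_of_lt z hj]
    refine add_pos_of_pos_of_nonneg (Real.exp_pos _) ?_
    cases j with
    | zero => exact le_rfl
    | succ j => exact expCoord_nonneg _ _
  have hB : ∀ j ∈ range m, 0 < expNegCoord z (j + 1) + expNegCoord y j := fun j hj => by
    rw [expNegCoord_of_lt z (by simpa using hj)]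
    exact add_pos_of_pos_of_nonneg (Real.exp_pos _) (expNegCoord_nonneg y j)
  rw [dintegral_kernel_mul_kernel _ _ z y le_rfl, dintegral_kernel_mul_kernel _ _ z y m.le_succ,
    prod_range_succ, expNegCoord_of_le z le_rfl, expNegCoord_of_le y le_rfl, add_zero,
    ← neg_sub τ τ', besselIntegral_zero_right _ (hA m m.lt_succ_self),
    prod_besselIntegral_neg (range m) _ (fun j hj => hA j (by have := mem_range.1 hj; omega)) hB,
    neg_neg]
  have hexp : dexp (τ * (∑ j, z j : ℝ) - τ' * (∑ j, y j : ℝ))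
        * (dexp (-(τ - τ') * (∑ j ∈ range m, (Real.log (expCoord z j + expCoordPred y j)
          - Real.log (expNegCoord z (j + 1) + expNegCoord y j)) : ℝ))
        * dexp (-(τ - τ') * Real.log (expCoord z m + expCoordPred y m)))
      = dexp (τ' * (∑ j, z j : ℝ) - τ * (∑ j, y j : ℝ)) := by
    rw [← dexp_add, ← mul_add, ← Complex.ofReal_add,
      sum_log_expCoord_sub_log z y m.lt_succ_self le_rfl, sum_range_coord z le_rfl,
      sum_range_coord y le_rfl, ← dexp_add]
    congr 1
    push_cast
    ring
  rw [← hexp]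
  ac_rfl

/-- The `GL` wave function with parameters `-σ`, that is `glWave` at `i σ`, as a dominated complex
number. -/
def dGLWave : (n : ℕ) → (Fin n → ℂ) → (Fin n → ℝ) → DominatedComplex
  | 0, _ => fun _ => 1
  | m + 1, σ => fun x => ∫ᵈ (y : Fin m → ℝ),
      kernel (-σ (Fin.last m)) x y * dGLWave m (fun j => σ j.castSucc) y

/-- The common kernel of the raising operator (`n = m + 1`) and the Baxter operator (`n = m`) of
the `BC` Toda chain, without the normalizing constant and conjugated by the factor `wall`. -/
def bcTransfer (a : ℝ) (g τ : ℂ) (x : Fin n → ℝ) (y : Fin m → ℝ) : DominatedComplex :=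
  ∫ᵈ (z : Fin n → ℝ),
    kernel τ z x * of (posCpow (gate a z) (g + τ - 1)) * (kernel τ z y * wall a y)

/-- The `BC` wave function as a dominated complex number, in the normalization of `bcTransfer`. -/
def dBCWave (a : ℝ) (g : ℂ) : (n : ℕ) → (Fin n → ℂ) → (Fin n → ℝ) → DominatedComplex
  | 0, _ => fun _ => 1
  | m + 1, κ => fun x => ∫ᵈ (y : Fin m → ℝ),
      bcTransfer a g (-κ (Fin.last m)) x y * dBCWave a g m (fun j => κ j.castSucc) y

@[fun_prop] theorem measurable_dGLWave (σ : Fin n → ℂ) : Measurable (dGLWave n σ) := by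
  induction n with
  | zero => exact measurable_const
  | succ m ih =>
    have := ih fun j => σ j.castSucc
    unfold dGLWave
    fun_prop

@[fun_prop] theorem measurable_bcTransfer (a : ℝ) (g τ : ℂ) :
    Measurable fun q : (Fin n → ℝ) × (Fin m → ℝ) => bcTransfer a g τ q.1 q.2 := by
  unfold bcTransfer
  fun_prop

@[fun_prop] theorem measurable_dBCWave (a : ℝ) (g : ℂ) (κ : Fin n → ℂ) :
    Measurable (dBCWave a g n κ) := by
  induction n with
  | zero => exact measurable_const
  | succ m ih =>
    have := ih fun j => κ j.castSucc
    unfold dBCWave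
    fun_prop

@[simp] theorem kernel_fin_zero (τ : ℂ) (z y : Fin 0 → ℝ) : kernel τ z y = 1 := by
  simp [kernel, interaction]

theorem dintegral_kernel_mul_dGLWave (τ : ℂ) (σ : Fin n → ℂ) (z : Fin n → ℝ) :
    ∫ᵈ (x : Fin n → ℝ), kernel τ z x * dGLWave n σ x
      = (∏ j, dGamma (σ j + τ)) * dGLWave n σ z := by
  induction n with
  | zero => simp [dintegral_fin_zero, dGLWave]
  | succ m ih =>
    set s := σ (Fin.last m)
    set σ' : Fin m → ℂ := fun j => σ j.castSucc
    calc ∫ᵈ (x : Fin (m + 1) → ℝ), kernel τ z x * dGLWave (m + 1) σ x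
        = ∫ᵈ (x : Fin (m + 1) → ℝ), ∫ᵈ (y : Fin m → ℝ),
            kernel τ z x * (kernel (-s) x y * dGLWave m σ' y) :=
          dintegral_congr fun x => (dintegral_const_mul _ _ (by fun_prop)).symm
      _ = ∫ᵈ (y : Fin m → ℝ), ∫ᵈ (x : Fin (m + 1) → ℝ),
            kernel τ z x * (kernel (-s) x y * dGLWave m σ' y) := dintegral_swap (by fun_prop)
      _ = ∫ᵈ (y : Fin m → ℝ), ∫ᵈ (x : Fin m → ℝ),
            dGamma (s + τ) * (kernel (-s) z x * (kernel τ x y * dGLWave m σ' y)) := by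
          refine dintegral_congr fun y => ?_
          simp only [← mul_assoc]
          rw [dintegral_mul_const _ _ (by fun_prop), dintegral_kernel_exchange, sub_neg_eq_add,
            add_comm τ, ← dintegral_const_mul _ _ (by fun_prop),
            ← dintegral_mul_const _ _ (by fun_prop)]
          simp only [mul_assoc]
      _ = dGamma (s + τ) * ∫ᵈ (x : Fin m → ℝ), ∫ᵈ (y : Fin m → ℝ),
            kernel (-s) z x * (kernel τ x y * dGLWave m σ' y) := by
          rw [dintegral_const_mul₂ _ (by fun_prop), dintegral_swap (by fun_prop)]
      _ = dGamma (s + τ) * ∫ᵈ (x : Fin m → ℝ),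
            (∏ j, dGamma (σ' j + τ)) * (kernel (-s) z x * dGLWave m σ' x) :=
          congrArg _ (dintegral_congr fun x => by
            rw [dintegral_const_mul _ _ (by fun_prop), ih, mul_left_comm])
      _ = (∏ j, dGamma (σ j + τ)) * dGLWave (m + 1) σ z := by
          rw [dintegral_const_mul _ _ (by fun_prop), Fin.prod_univ_castSucc, ← mul_assoc,
            mul_comm (dGamma _)]
          rfl

/-- The boundary weight of the exchange of two transfer operators, as a function of two boundary
variables. -/
def reflectionWeight (g σ τ : ℂ) (p x : ℝ) : ℂ :=
  posCpow p (g + σ - 1) * posCpow x (g + τ - 1) * posCpow (1 - p * x) (-(σ + τ))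

@[fun_prop] theorem measurable_reflectionWeight (g σ τ : ℂ) :
    Measurable fun q : ℝ × ℝ => reflectionWeight g σ τ q.1 q.2 := by
  unfold reflectionWeight
  fun_prop

/-- The Riemann–Liouville transform of `reflectionWeight` in its second variable. -/
def reflectionKernel (g σ τ : ℂ) (p q : ℝ) : DominatedComplex :=
  riemannLiouville (σ - τ) (reflectionWeight g σ τ p) q

@[fun_prop] theorem measurable_reflectionKernel (g σ τ : ℂ) :
    Measurable fun q : ℝ × ℝ => reflectionKernel g σ τ q.1 q.2 := by
  unfold reflectionKernel riemannLiouville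
  fun_prop

theorem reflectionKernel_comm (g σ τ : ℂ) (p q : ℝ) :
    reflectionKernel g σ τ p q = reflectionKernel g σ τ q p := by
  have hzero : ∀ p, ∀ x ≤ 0, reflectionWeight g σ τ p x = 0 := fun p x hx => by
    rw [reflectionWeight, posCpow_of_nonpos hx, mul_zero, zero_mul]
  -- The rescaling `x = q * exp t` makes the integrand symmetric in `p` and `q`.
  rw [reflectionKernel, reflectionKernel,
    riemannLiouville_eq_posCpow_mul _ (by fun_prop) (hzero p),
    riemannLiouville_eq_posCpow_mul _ (by fun_prop) (hzero q),
    ← dintegral_const_mul _ _ (by fun_prop), ← dintegral_const_mul _ _ (by fun_prop)]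
  refine dintegral_congr fun t => ?_
  rw [mul_left_comm, mul_left_comm (of _) (dexp t), ← of_mul, ← of_mul]
  congr 2
  rcases le_or_gt p 0 with hp | hp
  · simp [reflectionWeight, posCpow_of_nonpos hp]
  rcases le_or_gt q 0 with hq | hq
  · simp [reflectionWeight, posCpow_of_nonpos hq]
  rw [reflectionWeight, reflectionWeight, posCpow_mul hp, posCpow_mul hq,
    show g + σ - 1 = (σ - τ) + (g + τ - 1) by ring, posCpow_add p (σ - τ), posCpow_add q (σ - τ),
    mul_left_comm p q]
  ring

theorem gate_le_one {a : ℝ} (ha : 0 < a) (z : Fin m → ℝ) : gate a z ≤ 1 :=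
  sub_le_self _ (mul_nonneg ha.le (expNegCoord_nonneg z 0))

theorem gate_lt_one {a : ℝ} (ha : 0 < a) (z : Fin (m + 1) → ℝ) : gate a z < 1 := by
  rw [gate_succ]
  exact sub_lt_self _ (mul_pos ha (Real.exp_pos _))

theorem posCpow_gate_mul_posCpow_gate_mul {a : ℝ} (ha : 0 < a) (r s s' : ℂ)
    {x : Fin (m + 1) → ℝ} {v : Fin p → ℝ} {c F G : DominatedComplex}
    (h : 0 < boundaryCoupling a x v →
      F = c * dexp (-r * Real.log (boundaryCoupling a x v)) * G) :
    of (posCpow (gate a x) s) * of (posCpow (gate a v) s') * F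
      = c * dexp (r * Real.log a)
        * (of (posCpow (gate a x) s * posCpow (gate a v) s'
          * posCpow (1 - gate a x * gate a v) (-r)) * G) := by
  rcases le_or_gt (gate a x) 0 with hx | hx
  · simp [posCpow_of_nonpos hx]
  have hgates : 0 < 1 - gate a x * gate a v := by
    have := mul_le_mul_of_nonneg_left (gate_le_one ha v) hx.le
    linarith [gate_lt_one ha x]
  have hcoupling : boundaryCoupling a x v = (1 - gate a x * gate a v) / a :=
    boundaryCoupling_eq ha.ne' x v
  have hexp : dexp (-r * Real.log (boundaryCoupling a x v))
      = dexp (r * Real.log a) * of (posCpow (1 - gate a x * gate a v) (-r)) := by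
    rw [posCpow_of_pos hgates, hcoupling, Real.log_div hgates.ne' ha.ne', ← dexp, ← dexp_add]
    congr 1
    push_cast
    ring
  rw [h (hcoupling ▸ div_pos hgates ha), hexp, of_mul, of_mul]
  ac_rfl

theorem posCpow_mul_dintegral_wall {a : ℝ} (ha : 0 < a) (g σ τ : ℂ) (u z : Fin (m + 1) → ℝ) :
    of (posCpow (gate a u) (g + σ - 1)) * of (posCpow (gate a z) (g + τ - 1))
        * ∫ᵈ (y : Fin (m + 1) → ℝ), kernel σ u y * wall a y * kernel τ z y
      = dGamma (σ + τ) * dexp ((σ + τ) * Real.log a)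
        * (of (reflectionWeight g σ τ (gate a u) (gate a z))
          * ∫ᵈ (v : Fin m → ℝ), kernel (-τ) u v * wall a v * kernel (-σ) z v) :=
  posCpow_gate_mul_posCpow_gate_mul ha _ _ _ (dintegral_wall_exchange σ τ)

theorem posCpow_mul_dintegral_wall_of_lt {a : ℝ} (ha : 0 < a) (g σ τ : ℂ)
    (u : Fin (m + 1) → ℝ) (z : Fin m → ℝ) :
    of (posCpow (gate a u) (g + τ - 1)) * of (posCpow (gate a z) (g + σ - 1))
        * ∫ᵈ (v : Fin m → ℝ), kernel τ u v * wall a v * kernel σ z v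
      = dexp ((σ + τ) * Real.log a) * (of (reflectionWeight g σ τ (gate a z) (gate a u))
        * ∫ᵈ (v : Fin m → ℝ), kernel (-σ) u v * wall a v * kernel (-τ) z v) := by
  rw [posCpow_gate_mul_posCpow_gate_mul ha (σ + τ) _ _ (c := 1) fun h => by
      rw [dintegral_wall_exchange_of_lt τ σ h, add_comm τ, one_mul],
    one_mul, reflectionWeight, mul_comm (gate a z), mul_comm (posCpow (gate a z) _)]

/-- The integrand in which both orders of the product of a Baxter operator and a raising operator
of the `BC` chain agree. -/
def exchangeKernel (a : ℝ) (g σ τ : ℂ) (x : Fin (m + 1) → ℝ) (y : Fin m → ℝ)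
    (u : Fin (m + 1) → ℝ) (v z : Fin m → ℝ) : DominatedComplex :=
  kernel σ u x * (kernel (-τ) u v * wall a v) * wall a y
    * (kernel (-τ) z v * reflectionKernel g σ τ (gate a u) (gate a z)
      * kernel σ z y)

theorem dintegral_bcTransfer_mul_bcTransfer {a : ℝ} (ha : 0 < a) (g σ τ : ℂ)
    (x : Fin (m + 1) → ℝ) (y : Fin m → ℝ) :
    ∫ᵈ (w : Fin (m + 1) → ℝ), bcTransfer a g σ x w * bcTransfer a g τ w y
      = dGamma (σ + τ) * (dexp ((σ + τ) * Real.log a) * dexp ((τ - σ) * Real.log a))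
        * ∫ᵈ (u : Fin (m + 1) → ℝ), ∫ᵈ (v : Fin m → ℝ), ∫ᵈ (z : Fin m → ℝ),
          exchangeKernel a g σ τ x y u v z := by
  calc _ = ∫ᵈ (w : Fin (m + 1) → ℝ), ∫ᵈ (u : Fin (m + 1) → ℝ), ∫ᵈ (z : Fin (m + 1) → ℝ),
          kernel σ u x * of (posCpow (gate a u) (g + σ - 1)) * (kernel σ u w * wall a w)
            * (kernel τ z w * of (posCpow (gate a z) (g + τ - 1))
              * (kernel τ z y * wall a y)) :=
        dintegral_congr fun w => dintegral_mul_dintegral (by fun_prop) (by fun_prop)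
    _ = ∫ᵈ (u : Fin (m + 1) → ℝ), ∫ᵈ (z : Fin (m + 1) → ℝ), ∫ᵈ (w : Fin (m + 1) → ℝ),
          kernel σ u x * of (posCpow (gate a u) (g + σ - 1)) * (kernel σ u w * wall a w)
            * (kernel τ z w * of (posCpow (gate a z) (g + τ - 1))
              * (kernel τ z y * wall a y)) := dintegral_rotate (by fun_prop)
    _ = ∫ᵈ (u : Fin (m + 1) → ℝ), ∫ᵈ (z : Fin (m + 1) → ℝ),
          dGamma (σ + τ) * dexp ((σ + τ) * Real.log a) * ∫ᵈ (v : Fin m → ℝ),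
          kernel σ u x * (kernel (-τ) u v * wall a v) * wall a y
            * (kernel (-σ) z v * of (reflectionWeight g σ τ (gate a u) (gate a z))
              * kernel τ z y) := by
        refine dintegral_congr fun u => dintegral_congr fun z => ?_
        rw [dintegral_congr (G := fun w => kernel σ u x * (kernel τ z y * wall a y)
            * (of (posCpow (gate a u) (g + σ - 1)) * of (posCpow (gate a z) (g + τ - 1)))
            * (kernel σ u w * wall a w * kernel τ z w)) fun w => by ac_rfl,
          dintegral_const_mul _ _ (by fun_prop), mul_assoc, posCpow_mul_dintegral_wall ha,
          mul_left_comm, ← mul_assoc (kernel σ u x * _), ← dintegral_const_mul _ _ (by fun_prop)]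
        exact congrArg _ (dintegral_congr fun v => by ac_rfl)
    _ = dGamma (σ + τ) * dexp ((σ + τ) * Real.log a)
          * ∫ᵈ (u : Fin (m + 1) → ℝ), ∫ᵈ (v : Fin m → ℝ), ∫ᵈ (z : Fin (m + 1) → ℝ),
          kernel σ u x * (kernel (-τ) u v * wall a v) * wall a y
            * (kernel (-σ) z v * of (reflectionWeight g σ τ (gate a u) (gate a z))
              * kernel τ z y) := by
        rw [dintegral_const_mul₂ _ (by fun_prop)]
        exact congrArg _ (dintegral_congr fun u => dintegral_swap (by fun_prop))
    _ = _ := by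
        rw [← mul_assoc (dGamma _), mul_assoc _ (dexp ((τ - σ) * _)),
          ← dintegral_const_mul₂ (dexp ((τ - σ) * Real.log a)) (by unfold exchangeKernel; fun_prop)]
        refine congrArg _ (dintegral_congr fun u => dintegral_congr fun v => ?_)
        rw [dintegral_const_mul _ _ (by fun_prop), dintegral_gate_exchange ha _ _ (by fun_prop),
          neg_neg, show -(-σ + τ) = σ - τ by ring, neg_add_eq_sub, mul_left_comm,
          ← dintegral_const_mul _ _ (by fun_prop)]
        rfl

theorem dGamma_mul_dintegral_reflectionWeight {a : ℝ} (ha : 0 < a) (g σ τ : ℂ)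
    (x : Fin (m + 1) → ℝ) (y v z : Fin m → ℝ) :
    dGamma (σ - τ) * ∫ᵈ (u : Fin (m + 1) → ℝ),
        wall a v * kernel (-τ) z v * kernel σ z y * wall a y
          * (kernel τ u x * of (reflectionWeight g σ τ (gate a z) (gate a u)) * kernel (-σ) u v)
      = dexp ((τ - σ) * Real.log a)
        * ∫ᵈ (u : Fin (m + 1) → ℝ), exchangeKernel a g σ τ x y u v z := by
  have hgate := dGamma_mul_dintegral_gate_exchange ha τ (-σ)
    (k := reflectionWeight g σ τ (gate a z)) (by fun_prop) x v
  rw [show -(τ + -σ) = σ - τ by ring, ← sub_eq_add_neg, neg_neg] at hgate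
  rw [dintegral_const_mul _ _ (by fun_prop), mul_left_comm, hgate, mul_left_comm,
    ← dintegral_const_mul _ _ (by fun_prop)]
  refine congrArg _ (dintegral_congr fun u => ?_)
  rw [exchangeKernel, reflectionKernel_comm, reflectionKernel]
  ac_rfl

theorem dGamma_mul_dintegral_bcTransfer_mul_bcTransfer {a : ℝ} (ha : 0 < a) (g σ τ : ℂ)
    (x : Fin (m + 1) → ℝ) (y : Fin m → ℝ) :
    dGamma (σ - τ) * ∫ᵈ (w : Fin m → ℝ), bcTransfer a g τ x w * bcTransfer a g σ w y
      = dexp ((σ + τ) * Real.log a) * dexp ((τ - σ) * Real.log a)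
        * ∫ᵈ (u : Fin (m + 1) → ℝ), ∫ᵈ (v : Fin m → ℝ), ∫ᵈ (z : Fin m → ℝ),
          exchangeKernel a g σ τ x y u v z := by
  calc _ = dGamma (σ - τ) * ∫ᵈ (u : Fin (m + 1) → ℝ), ∫ᵈ (z : Fin m → ℝ), ∫ᵈ (w : Fin m → ℝ),
          kernel τ u x * of (posCpow (gate a u) (g + τ - 1)) * (kernel τ u w * wall a w)
            * (kernel σ z w * of (posCpow (gate a z) (g + σ - 1))
              * (kernel σ z y * wall a y)) := by
        rw [← dintegral_rotate (by fun_prop)]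
        exact congrArg _ (dintegral_congr fun w =>
          dintegral_mul_dintegral (by fun_prop) (by fun_prop))
    _ = dGamma (σ - τ) * ∫ᵈ (u : Fin (m + 1) → ℝ), ∫ᵈ (z : Fin m → ℝ),
          dexp ((σ + τ) * Real.log a) * ∫ᵈ (v : Fin m → ℝ),
          wall a v * kernel (-τ) z v * kernel σ z y * wall a y
            * (kernel τ u x * of (reflectionWeight g σ τ (gate a z) (gate a u))
              * kernel (-σ) u v) := by
        refine congrArg _ (dintegral_congr fun u => dintegral_congr fun z => ?_)
        rw [dintegral_congr (G := fun w => kernel τ u x * (kernel σ z y * wall a y)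
            * (of (posCpow (gate a u) (g + τ - 1)) * of (posCpow (gate a z) (g + σ - 1)))
            * (kernel τ u w * wall a w * kernel σ z w)) fun w => by ac_rfl,
          dintegral_const_mul _ _ (by fun_prop), mul_assoc, posCpow_mul_dintegral_wall_of_lt ha,
          mul_left_comm, ← mul_assoc (kernel τ u x * _), ← dintegral_const_mul _ _ (by fun_prop)]
        exact congrArg _ (dintegral_congr fun v => by ac_rfl)
    _ = dexp ((σ + τ) * Real.log a) * ∫ᵈ (v : Fin m → ℝ), ∫ᵈ (z : Fin m → ℝ),
          dGamma (σ - τ) * ∫ᵈ (u : Fin (m + 1) → ℝ),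
          wall a v * kernel (-τ) z v * kernel σ z y * wall a y
            * (kernel τ u x * of (reflectionWeight g σ τ (gate a z) (gate a u))
              * kernel (-σ) u v) := by
        rw [dintegral_const_mul₂ _ (by fun_prop), dintegral_rotate (by fun_prop),
          dintegral_swap (by fun_prop), dintegral_const_mul₂ _ (by fun_prop), mul_left_comm]
    _ = dexp ((σ + τ) * Real.log a) * ∫ᵈ (v : Fin m → ℝ), ∫ᵈ (z : Fin m → ℝ),
          dexp ((τ - σ) * Real.log a)
            * ∫ᵈ (u : Fin (m + 1) → ℝ), exchangeKernel a g σ τ x y u v z := by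
        exact congrArg _ (dintegral_congr fun v => dintegral_congr fun z =>
          dGamma_mul_dintegral_reflectionWeight ha g σ τ x y v z)
    _ = _ := by
        have hmeas : Measurable fun q : (Fin (m + 1) → ℝ) × (Fin m → ℝ) × (Fin m → ℝ) =>
            exchangeKernel a g σ τ x y q.1 q.2.1 q.2.2 := by
          unfold exchangeKernel; fun_prop
        rw [dintegral_const_mul₂ _ (by fun_prop), dintegral_rotate hmeas, mul_assoc]

theorem dintegral_bcTransfer_exchange {a : ℝ} (ha : 0 < a) (g σ τ : ℂ) (x : Fin (m + 1) → ℝ)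
    (y : Fin m → ℝ) :
    ∫ᵈ (w : Fin (m + 1) → ℝ), bcTransfer a g σ x w * bcTransfer a g τ w y
      = dGamma (σ + τ) * dGamma (σ - τ)
        * ∫ᵈ (w : Fin m → ℝ), bcTransfer a g τ x w * bcTransfer a g σ w y := by
  rw [dintegral_bcTransfer_mul_bcTransfer ha, mul_assoc (dGamma _) (dGamma _),
    dGamma_mul_dintegral_bcTransfer_mul_bcTransfer ha, mul_assoc]

theorem dintegral_bcTransfer_mul_dBCWave {a : ℝ} (ha : 0 < a) (g σ : ℂ) (κ : Fin n → ℂ)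
    (x : Fin n → ℝ) :
    ∫ᵈ (y : Fin n → ℝ), bcTransfer a g σ x y * dBCWave a g n κ y
      = (∏ k, dGamma (σ - κ k) * dGamma (σ + κ k)) * dBCWave a g n κ x := by
  induction n with
  | zero => simp [dintegral_fin_zero, dBCWave, bcTransfer, gate, wall, expNegCoord]
  | succ m ih =>
    set s := κ (Fin.last m)
    set κ' : Fin m → ℂ := fun j => κ j.castSucc
    calc ∫ᵈ (y : Fin (m + 1) → ℝ), bcTransfer a g σ x y * dBCWave a g (m + 1) κ y
        = ∫ᵈ (y : Fin (m + 1) → ℝ), ∫ᵈ (w : Fin m → ℝ),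
            bcTransfer a g σ x y * (bcTransfer a g (-s) y w * dBCWave a g m κ' w) :=
          dintegral_congr fun y => (dintegral_const_mul _ _ (by fun_prop)).symm
      _ = ∫ᵈ (w : Fin m → ℝ), ∫ᵈ (y : Fin (m + 1) → ℝ),
            bcTransfer a g σ x y * (bcTransfer a g (-s) y w * dBCWave a g m κ' w) :=
          dintegral_swap (by fun_prop)
      _ = ∫ᵈ (w : Fin m → ℝ), ∫ᵈ (v : Fin m → ℝ), dGamma (σ - s) * dGamma (σ + s)
            * (bcTransfer a g (-s) x v * (bcTransfer a g σ v w * dBCWave a g m κ' w)) := by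
          refine dintegral_congr fun w => ?_
          simp only [← mul_assoc]
          rw [dintegral_mul_const _ _ (by fun_prop), dintegral_bcTransfer_exchange ha,
            ← sub_eq_add_neg, sub_neg_eq_add, ← dintegral_const_mul _ _ (by fun_prop),
            ← dintegral_mul_const _ _ (by fun_prop)]
          simp only [mul_assoc]
      _ = dGamma (σ - s) * dGamma (σ + s) * ∫ᵈ (v : Fin m → ℝ), ∫ᵈ (w : Fin m → ℝ),
            bcTransfer a g (-s) x v * (bcTransfer a g σ v w * dBCWave a g m κ' w) := by
          rw [dintegral_const_mul₂ _ (by fun_prop), dintegral_swap (by fun_prop)]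
      _ = dGamma (σ - s) * dGamma (σ + s) * ∫ᵈ (v : Fin m → ℝ),
            (∏ k, dGamma (σ - κ' k) * dGamma (σ + κ' k))
              * (bcTransfer a g (-s) x v * dBCWave a g m κ' v) :=
          congrArg _ (dintegral_congr fun v => by
            rw [dintegral_const_mul _ _ (by fun_prop), ih, mul_left_comm])
      _ = _ := by
          rw [dintegral_const_mul _ _ (by fun_prop), Fin.prod_univ_castSucc, ← mul_assoc,
            mul_comm (dGamma _ * _)]
          rfl

/-- The scalar product of a wave function of the `GL` chain with a partially applied transfer
operator: the intermediate quantity through which a wave function of the `BC` chain loses one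
variable. -/
def bcPairing (a : ℝ) (g τ : ℂ) (σ : Fin n → ℂ) (κ : Fin m → ℂ) : DominatedComplex :=
  ∫ᵈ (y : Fin m → ℝ), ∫ᵈ (z : Fin n → ℝ), dGLWave n σ z
    * (of (posCpow (gate a z) (g + τ - 1)) * (kernel τ z y * wall a y) * dBCWave a g m κ y)

theorem dintegral_dGLWave_mul_bcTransfer (a : ℝ) (g τ : ℂ) (σ : Fin n → ℂ) (κ : Fin m → ℂ) :
    ∫ᵈ (x : Fin n → ℝ), dGLWave n σ x
        * ∫ᵈ (y : Fin m → ℝ), bcTransfer a g τ x y * dBCWave a g m κ y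
      = (∏ j, dGamma (σ j + τ)) * bcPairing a g τ σ κ := by
  calc _ = ∫ᵈ (x : Fin n → ℝ), ∫ᵈ (y : Fin m → ℝ), ∫ᵈ (z : Fin n → ℝ),
          kernel τ z x * dGLWave n σ x * (of (posCpow (gate a z) (g + τ - 1))
            * (kernel τ z y * wall a y) * dBCWave a g m κ y) := by
        refine dintegral_congr fun x => ?_
        rw [← dintegral_const_mul _ _ (by fun_prop)]
        refine dintegral_congr fun y => ?_
        rw [bcTransfer, ← dintegral_mul_const _ _ (by fun_prop),
          ← dintegral_const_mul _ _ (by fun_prop)]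
        exact dintegral_congr fun z => by ac_rfl
    _ = ∫ᵈ (y : Fin m → ℝ), ∫ᵈ (z : Fin n → ℝ), ∫ᵈ (x : Fin n → ℝ),
          kernel τ z x * dGLWave n σ x * (of (posCpow (gate a z) (g + τ - 1))
            * (kernel τ z y * wall a y) * dBCWave a g m κ y) := dintegral_rotate (by fun_prop)
    _ = _ := by
        rw [bcPairing, ← dintegral_const_mul₂ _ (by fun_prop)]
        refine dintegral_congr fun y => dintegral_congr fun z => ?_
        rw [dintegral_mul_const _ _ (by fun_prop), dintegral_kernel_mul_dGLWave, mul_assoc]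

theorem dintegral_gate_exchange_posCpow {a : ℝ} (ha : 0 < a) (g s t : ℂ) (v y : Fin m → ℝ) :
    ∫ᵈ (z : Fin (m + 1) → ℝ),
        kernel (-s) z v * of (posCpow (gate a z) (g - t - 1)) * kernel (-t) z y
      = dexp (-(s + t) * Real.log a) * dBeta (s + t) (g - t) * ∫ᵈ (u : Fin m → ℝ),
          kernel t u v * of (posCpow (gate a u) (g + s - 1)) * kernel s u y := by
  rw [dintegral_gate_exchange ha _ _ (k := fun q => posCpow q (g - t - 1)) (by fun_prop), neg_neg,
    neg_neg, ← neg_add, neg_neg, mul_assoc, ← dintegral_const_mul _ (dBeta _ _) (by fun_prop)]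
  refine congrArg _ (dintegral_congr fun u => ?_)
  rw [riemannLiouville_posCpow, show s + t + (g - t) - 1 = g + s - 1 by ring]
  ac_rfl

theorem bcPairing_succ {a : ℝ} (ha : 0 < a) (g t : ℂ) (σ : Fin (m + 1) → ℂ) (κ : Fin m → ℂ) :
    bcPairing a g (-t) σ κ
      = dexp (-(σ (Fin.last m) + t) * Real.log a) * dBeta (σ (Fin.last m) + t) (g - t)
        * (∏ j : Fin m, dGamma (σ j.castSucc + t))
        * bcPairing a g (σ (Fin.last m)) (fun j => σ j.castSucc) κ := by
  set s := σ (Fin.last m) with hs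
  set σ' : Fin m → ℂ := fun j => σ j.castSucc
  have hlower (y : Fin m → ℝ) :
      ∫ᵈ (z : Fin (m + 1) → ℝ), dGLWave (m + 1) σ z * (of (posCpow (gate a z) (g + -t - 1))
          * (kernel (-t) z y * wall a y) * dBCWave a g m κ y)
        = dexp (-(s + t) * Real.log a) * dBeta (s + t) (g - t) * (∏ j, dGamma (σ' j + t))
          * ∫ᵈ (u : Fin m → ℝ), dGLWave m σ' u * (of (posCpow (gate a u) (g + s - 1))
            * (kernel s u y * wall a y) * dBCWave a g m κ y) := by
    calc _ = ∫ᵈ (z : Fin (m + 1) → ℝ), ∫ᵈ (v : Fin m → ℝ),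
            dGLWave m σ' v * (wall a y * dBCWave a g m κ y)
              * (kernel (-s) z v * of (posCpow (gate a z) (g - t - 1)) * kernel (-t) z y) := by
          refine dintegral_congr fun z => ?_
          rw [dGLWave, ← dintegral_mul_const _ _ (by fun_prop), ← hs, ← sub_eq_add_neg]
          exact dintegral_congr fun v => by ac_rfl
      _ = ∫ᵈ (v : Fin m → ℝ), ∫ᵈ (u : Fin m → ℝ),
            dexp (-(s + t) * Real.log a) * dBeta (s + t) (g - t) * (kernel t u v * dGLWave m σ' v
              * (of (posCpow (gate a u) (g + s - 1)) * (kernel s u y * wall a y)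
                * dBCWave a g m κ y)) := by
          rw [dintegral_swap (by fun_prop)]
          refine dintegral_congr fun v => ?_
          rw [dintegral_const_mul _ _ (by fun_prop), dintegral_gate_exchange_posCpow ha,
            mul_left_comm, ← dintegral_const_mul _ (dGLWave _ _ _ * _) (by fun_prop),
            ← dintegral_const_mul _ (dexp _ * _) (by fun_prop)]
          exact dintegral_congr fun u => by ac_rfl
      _ = _ := by
          rw [dintegral_swap (by fun_prop), ← dintegral_const_mul _ _ (by fun_prop)]
          refine dintegral_congr fun u => ?_
          rw [dintegral_const_mul _ _ (by fun_prop), dintegral_mul_const _ _ (by fun_prop),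
            dintegral_kernel_mul_dGLWave]
          ac_rfl
  rw [bcPairing, bcPairing, ← dintegral_const_mul _ _ (by fun_prop)]
  exact dintegral_congr hlower

theorem prod_dGamma_mul_bcPairing {a : ℝ} (ha : 0 < a) (g s : ℂ) (σ κ : Fin m → ℂ) :
    (∏ j, dGamma (σ j + s)) * bcPairing a g s σ κ
      = (∏ k, dGamma (s - κ k) * dGamma (s + κ k))
        * ∫ᵈ (x : Fin m → ℝ), dGLWave m σ x * dBCWave a g m κ x := by
  rw [← dintegral_dGLWave_mul_bcTransfer, ← dintegral_const_mul _ _ (by fun_prop)]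
  exact dintegral_congr fun x => by rw [dintegral_bcTransfer_mul_dBCWave ha, mul_left_comm]

theorem dintegral_dGLWave_mul_dBCWave_succ {a : ℝ} (ha : 0 < a) (g : ℂ)
    (σ κ : Fin (m + 1) → ℂ) :
    (∏ j : Fin m, dGamma (σ j.castSucc + σ (Fin.last m)))
        * ∫ᵈ (x : Fin (m + 1) → ℝ), dGLWave (m + 1) σ x * dBCWave a g (m + 1) κ x
      = (∏ j, dGamma (σ j - κ (Fin.last m)))
        * (∏ j : Fin m, dGamma (σ j.castSucc + κ (Fin.last m)))
        * (dexp (-(σ (Fin.last m) + κ (Fin.last m)) * Real.log a)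
          * dBeta (σ (Fin.last m) + κ (Fin.last m)) (g - κ (Fin.last m)))
        * ((∏ k : Fin m, dGamma (σ (Fin.last m) - κ k.castSucc)
            * dGamma (σ (Fin.last m) + κ k.castSucc))
          * ∫ᵈ (x : Fin m → ℝ), dGLWave m (fun j => σ j.castSucc) x
            * dBCWave a g m (fun j => κ j.castSucc) x) := by
  have hraise : ∫ᵈ (x : Fin (m + 1) → ℝ), dGLWave (m + 1) σ x * dBCWave a g (m + 1) κ x
      = (∏ j, dGamma (σ j - κ (Fin.last m)))
        * bcPairing a g (-κ (Fin.last m)) σ (fun j => κ j.castSucc) :=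
    dintegral_dGLWave_mul_bcTransfer a g (-κ (Fin.last m)) σ fun j => κ j.castSucc
  rw [hraise, bcPairing_succ ha, ← prod_dGamma_mul_bcPairing ha]
  ac_rfl

theorem prod_prod_Ioi_castSucc {M : Type*} [CommMonoid M] (f : Fin (m + 1) → Fin (m + 1) → M) :
    ∏ j, ∏ k ∈ Ioi j, f j k
      = (∏ j : Fin m, ∏ k ∈ Ioi j, f j.castSucc k.castSucc)
        * ∏ j : Fin m, f j.castSucc (Fin.last m) := by
  have hite (n : ℕ) (F : Fin n → Fin n → M) (j : Fin n) :
      ∏ k ∈ Ioi j, F j k = ∏ k, if j < k then F j k else 1 := by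
    rw [← prod_filter, filter_lt_eq_Ioi]
  simp only [hite _ f, hite _ fun j k : Fin m => f j.castSucc k.castSucc]
  rw [Fin.prod_univ_castSucc, ← prod_mul_distrib]
  simp only [Fin.prod_univ_castSucc, Fin.castSucc_lt_castSucc_iff, Fin.castSucc_lt_last, if_true,
    (Fin.castSucc_lt_last _).not_gt, lt_irrefl, if_false, prod_const_one, mul_one]

theorem prod_dGamma_mul_dintegral_dGLWave_mul_dBCWave {a : ℝ} (ha : 0 < a) (g : ℂ)
    (σ κ : Fin n → ℂ) :
    (∏ j, ∏ k ∈ Ioi j, dGamma (σ j + σ k)) * (∏ j, dGamma (g + σ j))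
        * ∫ᵈ (x : Fin n → ℝ), dGLWave n σ x * dBCWave a g n κ x
      = dexp (-(∑ j, σ j + ∑ k, κ k) * Real.log a)
        * (∏ j, ∏ k, dGamma (σ j + κ k) * dGamma (σ j - κ k)) * ∏ k, dGamma (g - κ k) := by
  induction n with
  | zero => simp [dintegral_fin_zero, dGLWave, dBCWave]
  | succ m ih =>
    set s := σ (Fin.last m) with hs
    set t := κ (Fin.last m) with ht
    have hbeta : dGamma (g + s) * dBeta (s + t) (g - t) = dGamma (s + t) * dGamma (g - t) := by
      rw [dGamma_mul_dGamma, show s + t + (g - t) = g + s by ring]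
    have hexp : dexp (-(∑ j, σ j + ∑ k, κ k) * Real.log a) = dexp (-(s + t) * Real.log a)
        * dexp (-(∑ j : Fin m, σ j.castSucc + ∑ k : Fin m, κ k.castSucc) * Real.log a) := by
      rw [← dexp_add, Fin.sum_univ_castSucc, Fin.sum_univ_castSucc]
      congr 1
      ring
    have hsucc := dintegral_dGLWave_mul_dBCWave_succ ha g σ κ
    rw [← hs, ← ht] at hsucc
    rw [prod_prod_Ioi_castSucc, Fin.prod_univ_castSucc fun j => dGamma (g + σ j), hexp]
    calc _ = (∏ j : Fin m, ∏ k ∈ Ioi j, dGamma (σ j.castSucc + σ k.castSucc))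
          * (∏ j : Fin m, dGamma (g + σ j.castSucc)) * dGamma (g + s)
          * ((∏ j : Fin m, dGamma (σ j.castSucc + s))
            * ∫ᵈ (x : Fin (m + 1) → ℝ), dGLWave (m + 1) σ x * dBCWave a g (m + 1) κ x) := by
          ac_rfl
      _ = dGamma (g + s) * dBeta (s + t) (g - t) * ((∏ j, dGamma (σ j - t))
          * (∏ j : Fin m, dGamma (σ j.castSucc + t)) * dexp (-(s + t) * Real.log a)
          * ∏ k : Fin m, dGamma (s - κ k.castSucc) * dGamma (s + κ k.castSucc))
          * ((∏ j : Fin m, ∏ k ∈ Ioi j, dGamma (σ j.castSucc + σ k.castSucc))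
            * (∏ j : Fin m, dGamma (g + σ j.castSucc)) * ∫ᵈ (x : Fin m → ℝ),
              dGLWave m (fun j => σ j.castSucc) x * dBCWave a g m (fun k => κ k.castSucc) x) := by
          rw [hsucc]
          ac_rfl
      _ = _ := by
          rw [hbeta, ih]
          simp only [Fin.prod_univ_castSucc, prod_mul_distrib, ← hs, ← ht]
          ac_rfl

theorem interaction_succ (x : Fin (m + 1) → ℝ) (y : Fin m → ℝ) :
    interaction x y = ∑ j : Fin m, (Real.exp (x j.castSucc - y j) + Real.exp (y j - x j.succ)) := by
  rw [interaction, sum_range_succ, expNegCoord_of_le y le_rfl, expCoord_of_le y le_rfl, mul_zero,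
    zero_mul, add_zero, add_zero, sum_range]
  simp only [expCoord_castSucc x, expNegCoord_succ x, expCoord_fin y, expNegCoord_fin y,
    ← Real.exp_add, ← sub_eq_add_neg]

theorem interaction_succ_succ (z x : Fin (m + 1) → ℝ) :
    interaction z x = ∑ j : Fin m, (Real.exp (z j.castSucc - x j.castSucc)
      + Real.exp (x j.castSucc - z j.succ)) + Real.exp (z (Fin.last m) - x (Fin.last m)) := by
  have hlast : expCoord z m = Real.exp (z (Fin.last m)) := expCoord_fin z (Fin.last m)
  have hlast' : expNegCoord x m = Real.exp (-x (Fin.last m)) := expNegCoord_fin x (Fin.last m)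
  have hcast (j : Fin m) : expNegCoord x j = Real.exp (-x j.castSucc) :=
    expNegCoord_fin x j.castSucc
  rw [interaction, sum_range_succ, expNegCoord_of_le z le_rfl, mul_zero, add_zero, sum_range,
    hlast, hlast']
  simp only [expCoord_castSucc, expNegCoord_succ z, hcast, ← Real.exp_add, ← sub_eq_add_neg]

theorem kernel_eq_glKernel (lam : ℂ) (x : Fin (m + 1) → ℝ) (y : Fin m → ℝ) :
    kernel (Complex.I * lam) x y = of (glKernel lam x y) := by
  rw [kernel, glKernel, dexp, interaction_succ]

theorem represents_dGLWave (ρ : Fin n → ℂ) (x : Fin n → ℝ) :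
    (dGLWave n (fun j => Complex.I * ρ j) x).Represents (glWave n (fun j => -ρ j) x) := by
  induction n with
  | zero => exact fun _ => rfl
  | succ m ih =>
    refine Represents.dintegral (by fun_prop) fun y => ?_
    rw [← mul_neg, kernel_eq_glKernel]
    exact (represents_of _).mul (ih _ y)

@[fun_prop] theorem measurable_bcBoundary (β g : ℝ) (lam : ℂ) :
    Measurable (bcBoundary β g lam) := by
  have hheaviside : Measurable heaviside :=
    Measurable.ite measurableSet_Ici measurable_const measurable_const
  unfold bcBoundary
  fun_prop

theorem bcBoundary_eq {β : ℝ} (hβ : 0 < β) (g : ℝ) (lam : ℂ) {t : ℝ} (ht : t ≠ Real.log β) :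
    bcBoundary β g lam t = posCpow (1 + β * Real.exp (-t)) (-(Complex.I * lam) - g)
      * posCpow (1 - β * Real.exp (-t)) (-(Complex.I * lam) + g - 1) := by
  have hexp : β * Real.exp (-t) = Real.exp (Real.log β - t) := by
    rw [sub_eq_add_neg, Real.exp_add, Real.exp_log hβ]
  rw [bcBoundary, posCpow_eq_cpow (by positivity)]
  rcases ht.lt_or_gt with ht | ht
  · rw [heaviside, if_neg (by linarith), posCpow_of_nonpos]
    · simp
    · rw [hexp, sub_nonpos, Real.one_le_exp_iff]
      linarith
  · rw [heaviside, if_pos (by linarith), posCpow_eq_cpow, Complex.ofReal_one, mul_one]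
    rw [hexp, sub_pos, Real.exp_lt_one_iff]
    linarith

-- The substitution `t ↦ log (exp t + β)` turns the two boundary factors into one.
theorem dintegral_besselWeight_mul_bcBoundary {β : ℝ} (hβ : 0 < β) (g : ℝ) (lam : ℂ) (B : ℝ) :
    dexp (-(β * B : ℝ)) * ∫ᵈ (t : ℝ), besselWeight (-(Complex.I * lam) + -(Complex.I * lam)) 0 B t
        * of (bcBoundary β g lam t)
      = ∫ᵈ (t : ℝ), besselWeight (-(Complex.I * lam) + -(Complex.I * lam)) 0 B t
        * of (posCpow (1 - 2 * β * Real.exp (-t)) (g + -(Complex.I * lam) - 1)) := by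
  set τ := -(Complex.I * lam)
  have hboundary : ∀ᵐ t : ℝ, dexp (-(β * B : ℝ)) * (besselWeight (τ + τ) 0 B t
        * of (bcBoundary β g lam t))
      = dexp (-(β * B : ℝ)) * (besselWeight (τ + τ) 0 B t
        * of (posCpow (1 + β * Real.exp (-t)) (τ - g)
          * posCpow (1 - β * Real.exp (-t)) (τ + g - 1))) := by
    filter_upwards [Measure.ae_ne volume (Real.log β)] with t ht
    rw [bcBoundary_eq hβ g lam ht]
  have hzero (t : ℝ) (ht : Real.exp t ≤ β) : besselWeight (τ + τ) 0 B t
      * of (posCpow (1 - 2 * β * Real.exp (-t)) (g + τ - 1)) = 0 := by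
    rw [posCpow_of_nonpos, of_zero, mul_zero]
    rw [Real.exp_neg, sub_nonpos, ← div_eq_mul_inv, one_le_div (Real.exp_pos t)]
    linarith
  rw [dintegral_log_exp_add hβ hzero, ← dintegral_const_mul _ _ (by fun_prop),
    dintegral_congr_ae hboundary]
  refine dintegral_congr fun t => ?_
  set p := 1 + β * Real.exp (-t) with hp
  set q := 1 - β * Real.exp (-t) with hq
  have hp0 : 0 < p := by positivity
  have hexp : Real.exp (t + Real.log p) = Real.exp t + β := exp_add_log_one_add_mul_exp_neg hp0
  have hquot : q = p * (1 - 2 * β * Real.exp (-(t + Real.log p))) := by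
    rw [neg_add, Real.exp_add, Real.exp_neg (Real.log p), Real.exp_log hp0]
    field_simp
    rw [hp, hq]
    ring
  rw [hquot, posCpow_mul hp0, posCpow_of_pos hp0, posCpow_of_pos hp0, of_mul, of_mul, ← dexp,
    ← dexp, besselWeight, besselWeight, hexp, add_comm τ (g : ℂ)]
  simp only [← mul_assoc, ← dexp_add]
  congr 2
  push_cast
  ring

theorem bcTransfer_two_mul {β : ℝ} (hβ : 0 < β) (g : ℝ) (lam : ℂ) (x : Fin (m + 1) → ℝ)
    (y : Fin m → ℝ) :
    bcTransfer (2 * β) g (-(Complex.I * lam)) x y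
      = wall (-β) x * (∫ᵈ (z : Fin (m + 1) → ℝ), kernel (-(Complex.I * lam)) z x
        * of (bcBoundary β g lam (z 0)) * kernel (-(Complex.I * lam)) z y) * wall β y := by
  set τ := -(Complex.I * lam) with hτ
  have hwall : dexp (-(β * (expNegCoord x 0 + expNegCoord y 0) : ℝ)) * wall (2 * β) y
      = wall (-β) x * wall β y := by
    rw [wall, wall, wall, ← dexp_add, ← dexp_add]
    congr 1
    push_cast
    ring
  simp only [bcTransfer, ← mul_assoc, gate_succ]
  rw [dintegral_mul_const _ _ (by fun_prop),
    dintegral_kernel_mul_comp_mul_kernel τ τ x y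
      (k := fun t => of (posCpow (1 - 2 * β * Real.exp (-t)) (g + τ - 1))) (by fun_prop),
    dintegral_kernel_mul_comp_mul_kernel τ τ x y (k := fun t => of (bcBoundary β g lam t))
      (by fun_prop), ← dintegral_besselWeight_mul_bcBoundary hβ, ← hτ,
    mul_right_comm _ _ (wall β y), ← hwall]
  ac_rfl

/-- The constant in front of the integral in `bcKernel`. -/
def raiseConst (β g : ℝ) (lam : ℂ) : ℂ :=
  ((2 * β : ℝ) : ℂ) ^ (Complex.I * lam) / Complex.Gamma ((g : ℂ) - Complex.I * lam)

theorem represents_bcTransfer {β : ℝ} (hβ : 0 < β) (g : ℝ) (lam : ℂ) (x : Fin (m + 1) → ℝ)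
    (y : Fin m → ℝ) :
    (of (raiseConst β g lam) * bcTransfer (2 * β) g (-(Complex.I * lam)) x y).Represents
      (bcKernel β g lam x y * (wall (-β) x).val * (wall β y).val) := by
  have hkernel (z : Fin (m + 1) → ℝ) :
      kernel (-(Complex.I * lam)) z x * of (bcBoundary β g lam (z 0))
          * kernel (-(Complex.I * lam)) z y
        = of (bcBoundary β g lam (z 0) * Complex.exp
            (Complex.I * lam * (((∑ j, x j) + (∑ j, y j) - 2 * ∑ j, z j : ℝ) : ℂ)
              - ((∑ j : Fin m,
                    (Real.exp (z j.castSucc - x j.castSucc) + Real.exp (z j.castSucc - y j)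
                      + Real.exp (x j.castSucc - z j.succ) + Real.exp (y j - z j.succ)) : ℝ) : ℂ)
              - ((Real.exp (z (Fin.last m) - x (Fin.last m)) : ℝ) : ℂ))) := by
    rw [mul_comm (kernel _ z x), mul_assoc, kernel, kernel, ← dexp_add, of_mul, ← dexp,
      interaction_succ, interaction_succ_succ]
    simp only [sum_add_distrib]
    congr 2
    push_cast
    ring
  rw [bcTransfer_two_mul hβ, dintegral_congr hkernel, ← mul_assoc, mul_left_comm,
    mul_comm (wall (-β) x)]
  exact (((represents_of _).mul (.dintegral (by fun_prop) fun z => represents_of _)).mul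
    fun _ => rfl).mul fun _ => rfl

theorem wall_mul_wall_neg (a : ℝ) (y : Fin m → ℝ) : wall a y * wall (-a) y = 1 := by
  rw [wall, wall, ← dexp_add, ← dexp_zero]
  congr 1
  push_cast
  ring

theorem represents_dBCWave {β : ℝ} (hβ : 0 < β) (g : ℝ) (lam : Fin n → ℂ) (x : Fin n → ℝ) :
    (of (∏ k, raiseConst β g (lam k))
      * dBCWave (2 * β) g n (fun k => Complex.I * lam k) x).Represents
        (bcWave β g n lam x * (wall (-β) x).val) := by
  induction n with
  | zero => simp [dBCWave, bcWave, wall, expNegCoord, Represents]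
  | succ m ih =>
    set l := lam (Fin.last m)
    set c := ∏ k : Fin m, raiseConst β g (lam k.castSucc)
    set ψ := dBCWave (2 * β) g m fun k => Complex.I * lam k.castSucc
    have hd : of (∏ k, raiseConst β g (lam k))
          * dBCWave (2 * β) g (m + 1) (fun k => Complex.I * lam k) x
        = ∫ᵈ (y : Fin m → ℝ), of (raiseConst β g l) * bcTransfer (2 * β) g (-(Complex.I * l)) x y
          * (of c * ψ y) := by
      rw [Fin.prod_univ_castSucc, of_mul, dBCWave, ← dintegral_const_mul _ _ (by fun_prop)]
      exact dintegral_congr fun y => by simp only [l, c, ψ]; ac_rfl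
    have hwall (y : Fin m → ℝ) : (wall β y).val * (wall (-β) y).val = 1 := by
      rw [← val_mul, wall_mul_wall_neg, val_one]
    have hv : bcWave β g (m + 1) lam x * (wall (-β) x).val
        = ∫ y, bcKernel β g l x y * (wall (-β) x).val * (wall β y).val
          * (bcWave β g m (fun k => lam k.castSucc) y * (wall (-β) y).val) := by
      rw [bcWave, bcRaise, ← integral_mul_const]
      refine integral_congr_ae (.of_forall fun y => ?_)
      linear_combination -(bcKernel β g l x y * (wall (-β) x).val
        * bcWave β g m (fun k => lam k.castSucc) y * hwall y)
    rw [hd, hv]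
    exact .dintegral (by fun_prop) fun y => (represents_bcTransfer hβ g l x y).mul (ih _ y)

theorem val_wall_neg (β : ℝ) (hn : 0 < n) (x : Fin n → ℝ) :
    (wall (-β) x).val = (Real.exp (-β * Real.exp (-x ⟨0, hn⟩)) : ℂ) := by
  rw [wall, dexp, val_of, expNegCoord, dif_pos hn, Complex.ofReal_exp]

theorem bound_ne_top_and_val_dintegral_dGLWave_mul_dBCWave {a : ℝ} (ha : 0 < a) {g : ℂ}
    {σ κ : Fin n → ℂ} (hg : ∀ k, 0 < (g - κ k).re) (hadd : ∀ j k, 0 < (σ j + κ k).re)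
    (hsub : ∀ j k, 0 < (σ j - κ k).re) :
    (∫ᵈ (x : Fin n → ℝ), dGLWave n σ x * dBCWave a g n κ x).bound ≠ ∞ ∧
      (∫ᵈ (x : Fin n → ℝ), dGLWave n σ x * dBCWave a g n κ x).val
        = Complex.exp (-(∑ j, σ j + ∑ k, κ k) * Real.log a)
          * (∏ j, ∏ k, Complex.Gamma (σ j + κ k) * Complex.Gamma (σ j - κ k))
          * (∏ k, Complex.Gamma (g - κ k))
          / ((∏ j, ∏ k ∈ Ioi j, Complex.Gamma (σ j + σ k)) * ∏ j, Complex.Gamma (g + σ j)) := by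
  have hσ (j : Fin n) : 0 < (σ j).re := by
    have hadd := hadd j j
    have hsub := hsub j j
    rw [Complex.add_re] at hadd
    rw [Complex.sub_re] at hsub
    linarith
  have hσσ (j k : Fin n) : 0 < (σ j + σ k).re := add_pos (hσ j) (hσ k)
  have hgσ (j : Fin n) : 0 < (g + σ j).re := by
    rw [← sub_add_add_cancel g (σ j) (κ j)]
    exact add_pos (hg j) (hadd j j)
  have hright : (dexp (-(∑ j, σ j + ∑ k, κ k) * Real.log a)
      * (∏ j, ∏ k, dGamma (σ j + κ k) * dGamma (σ j - κ k))
      * ∏ k, dGamma (g - κ k)).bound ≠ ∞ := by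
    simp only [bound_mul, bound_prod]
    refine ENNReal.mul_ne_top (ENNReal.mul_ne_top enorm_ne_top ?_) ?_
    · exact ENNReal.prod_ne_top fun j _ => ENNReal.prod_ne_top fun k _ =>
        ENNReal.mul_ne_top (bound_dGamma_ne_top (hadd j k)) (bound_dGamma_ne_top (hsub j k))
    · exact ENNReal.prod_ne_top fun k _ => bound_dGamma_ne_top (hg k)
  have hleft : ((∏ j, ∏ k ∈ Ioi j, dGamma (σ j + σ k)) * ∏ j, dGamma (g + σ j)).val ≠ 0 := by
    simp only [val_mul, val_prod]
    exact mul_ne_zero (prod_ne_zero_iff.2 fun j _ => prod_ne_zero_iff.2 fun k _ =>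
      val_dGamma_ne_zero (hσσ j k)) (prod_ne_zero_iff.2 fun j _ => val_dGamma_ne_zero (hgσ j))
  have h := bound_ne_top_and_val_of_mul_eq
    (prod_dGamma_mul_dintegral_dGLWave_mul_dBCWave ha g σ κ) hright hleft
  simpa only [val_mul, val_prod, dexp, val_of, fun j k => val_dGamma (hadd j k),
    fun j k => val_dGamma (hsub j k), fun k => val_dGamma (hg k),
    fun j k => val_dGamma (hσσ j k), fun j => val_dGamma (hgσ j)] using h

theorem prod_raiseConst_mul_prod_Gamma {β g : ℝ} (hβ : 0 < β) {lam : Fin n → ℂ}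
    (hg : ∀ k, 0 < ((g : ℂ) - Complex.I * lam k).re) :
    (∏ k, raiseConst β g (lam k)) * ∏ k, Complex.Gamma (g - Complex.I * lam k)
      = Complex.exp ((∑ k, Complex.I * lam k) * Real.log (2 * β)) := by
  rw [← prod_mul_distrib, sum_mul, Complex.exp_sum]
  refine prod_congr rfl fun k _ => ?_
  rw [raiseConst, div_mul_cancel₀ _ (Complex.Gamma_ne_zero_of_re_pos (hg k)),
    ← posCpow_eq_cpow (by positivity), posCpow_of_pos (by positivity)]

theorem bound_ne_top_and_val_dintegral_dGLWave_mul_raiseConst_mul_dBCWave {β g : ℝ} (hβ : 0 < β)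
    {lam ρ : Fin n → ℂ} (hg : ∀ k, -g < (lam k).im) (hlam : ∀ j k, |(lam k).im| < -(ρ j).im) :
    (∫ᵈ (x : Fin n → ℝ), dGLWave n (fun j => Complex.I * ρ j) x
        * (of (∏ k, raiseConst β g (lam k))
          * dBCWave (2 * β) g n (fun k => Complex.I * lam k) x)).bound ≠ ∞ ∧
      (∫ᵈ (x : Fin n → ℝ), dGLWave n (fun j => Complex.I * ρ j) x
          * (of (∏ k, raiseConst β g (lam k))
            * dBCWave (2 * β) g n (fun k => Complex.I * lam k) x)).val
        = (((2 * β : ℝ) : ℂ) ^ (-(Complex.I * ∑ j, ρ j))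
            * ∏ j, ∏ k, (Complex.Gamma (Complex.I * ρ j + Complex.I * lam k)
                * Complex.Gamma (Complex.I * ρ j - Complex.I * lam k)))
          / ((∏ j, ∏ k ∈ Ioi j, Complex.Gamma (Complex.I * ρ j + Complex.I * ρ k))
            * ∏ j, Complex.Gamma (g + Complex.I * ρ j)) := by
  have hgκ (k : Fin n) : 0 < ((g : ℂ) - Complex.I * lam k).re := by
    simpa using neg_lt_iff_pos_add'.1 (hg k)
  have hre (j k : Fin n) : 0 < (Complex.I * ρ j + Complex.I * lam k).re
      ∧ 0 < (Complex.I * ρ j - Complex.I * lam k).re := by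
    have := abs_lt.1 (hlam j k)
    simp only [Complex.add_re, Complex.sub_re, Complex.I_mul_re]
    constructor <;> linarith
  obtain ⟨hfin, hval⟩ := bound_ne_top_and_val_dintegral_dGLWave_mul_dBCWave
    (a := 2 * β) (by positivity) hgκ (fun j k => (hre j k).1) fun j k => (hre j k).2
  have hpow : ((2 * β : ℝ) : ℂ) ^ (-(Complex.I * ∑ j, ρ j))
      = (∏ k, raiseConst β g (lam k)) * (∏ k, Complex.Gamma (g - Complex.I * lam k))
        * Complex.exp (-(∑ j, Complex.I * ρ j + ∑ k, Complex.I * lam k) * Real.log (2 * β)) := by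
    rw [prod_raiseConst_mul_prod_Gamma hβ hgκ, ← Complex.exp_add,
      ← posCpow_eq_cpow (by positivity), posCpow_of_pos (by positivity), mul_sum]
    ring_nf
  simp only [mul_left_comm (dGLWave _ _ _) (of _)]
  rw [dintegral_const_mul _ _ (by fun_prop), bound_mul, val_mul, hval, val_of, hpow]
  refine ⟨ENNReal.mul_ne_top (by simp) hfin, ?_⟩
  ring

end Toda

end

theorem proposition2p5_general {β : ℝ} (hβ : 0 < β) (g : ℝ) {n : ℕ} (hn : 0 < n)
    (lam ρ : Fin n → ℂ) (hg : ∀ k, -g < (lam k).im) (hlam : ∀ j k, |(lam k).im| < -(ρ j).im) :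
    Integrable (fun x : Fin n → ℝ =>
        Toda.glWave n (fun j => -ρ j) x * Toda.bcWave β g n lam x
          * ((Real.exp (-β * Real.exp (-x ⟨0, hn⟩)) : ℝ) : ℂ)) ∧
    ∫ x : Fin n → ℝ,
        Toda.glWave n (fun j => -ρ j) x * Toda.bcWave β g n lam x
          * ((Real.exp (-β * Real.exp (-x ⟨0, hn⟩)) : ℝ) : ℂ)
      = (((2 * β : ℝ) : ℂ) ^ (-(Complex.I * ∑ j, ρ j))
          * ∏ j, ∏ k, (Complex.Gamma (Complex.I * ρ j + Complex.I * lam k)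
              * Complex.Gamma (Complex.I * ρ j - Complex.I * lam k)))
        / ((∏ j, ∏ k ∈ Finset.Ioi j, Complex.Gamma (Complex.I * ρ j + Complex.I * ρ k))
          * ∏ j, Complex.Gamma ((g : ℂ) + Complex.I * ρ j)) := by
  have hrep (x : Fin n → ℝ) := (Toda.represents_dGLWave ρ x).mul
    (Toda.represents_dBCWave hβ g lam x)
  simp only [Toda.val_wall_neg β hn, ← mul_assoc (Toda.glWave _ _ _)] at hrep
  obtain ⟨hfin, hval⟩ :=
    Toda.bound_ne_top_and_val_dintegral_dGLWave_mul_raiseConst_mul_dBCWave hβ hg hlam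
  exact ⟨Toda.DominatedComplex.integrable_of_represents (by fun_prop) hrep hfin,
    (Toda.DominatedComplex.Represents.dintegral (by fun_prop) hrep hfin).symm.trans hval⟩

theorem proposition2p5 (α β : ℝ) (hβ : 0 < β) (hg : 0 < Toda.coupling α β)
    (n : ℕ) (hn : 0 < n) (lam : Fin n → ℝ) (ρ : Fin n → ℂ)
    (hρ_eq : ∀ j k, (ρ j).im = (ρ k).im) (hρ_neg : ∀ j, (ρ j).im < 0) :
    Integrable (fun x : Fin n → ℝ =>
        Toda.glWave n (fun j => -ρ j) x
          * Toda.bcWave β (Toda.coupling α β) n (fun j => (lam j : ℂ)) x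
          * ((Real.exp (-β * Real.exp (-x ⟨0, hn⟩)) : ℝ) : ℂ)) ∧
    ∫ x : Fin n → ℝ,
        Toda.glWave n (fun j => -ρ j) x
          * Toda.bcWave β (Toda.coupling α β) n (fun j => (lam j : ℂ)) x
          * ((Real.exp (-β * Real.exp (-x ⟨0, hn⟩)) : ℝ) : ℂ)
      = (((2 * β : ℝ) : ℂ) ^ (-(Complex.I * ∑ j, ρ j))
          * ∏ j, ∏ k, (Complex.Gamma (Complex.I * ρ j + Complex.I * (lam k : ℂ))
              * Complex.Gamma (Complex.I * ρ j - Complex.I * (lam k : ℂ))))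
        / ((∏ j, ∏ k ∈ Finset.Ioi j, Complex.Gamma (Complex.I * ρ j + Complex.I * ρ k))
          * ∏ j, Complex.Gamma (((Toda.coupling α β : ℝ) : ℂ) + Complex.I * ρ j)) := by
  exact proposition2p5_general hβ _ hn _ ρ (fun k => by simpa using hg) fun j k => by
    simpa using hρ_neg j
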